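/- Let $P$ be a distribution on $\mathcal X\times\mathbb R$ and $\theta^*=\mathbb E_P[Y]$. For each $n$, let $(X_1,Y_1),\dots,(X_n,Y_n)$ be i.i.d. from $P$, and let labels be collected sequentially: with $\mathcal F_t=\sigma((X_1,Y_1\xi_1,\xi_1),\dots,(X_t,Y_t\xi_t,\xi_t))$, the model $f_t:\mathcal X\to\mathbb R$ and the sampling rule $\pi_t:\mathcal X\to[0,1]$ are $\mathcal F_{t-1}$-measurable (as functions of the past and of the point, jointly measurable), $(X_t,Y_t)$ is independent of $\mathcal F_{t-1}$, and given $\mathcal F_{t-1}$ and $(X_t,Y_t)$ the decision $\xi_t\in\{0,1\}$ is $\mathrm{Bern}(\pi_t(X_t))$. All these objects may depend on $n$ (for example through the labelling budget). For a fixed model--rule pair let $$V(f,\pi)=\mathrm{Var}\Big(f(X)+(Y-f(X))\frac{\xi}{\pi(X)}\Big),\qquad (X,Y)\sim P,\ \xi\mid (X,Y)\sim\mathrm{Bern}(\pi(X)).$$ All pairs considered are measurable, with $V(f,\pi)<\infty$ and with $\pi(X)>0$ or $Y=f(X)$ almost surely (where $\pi(X)=0$ and $Y=f(X)$, the second summand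 is read as $0$); for the random pairs $(f_t,\pi_t)$ this is required almost surely. Let $$\Delta_t=f_t(X_t)+(Y_t-f_t(X_t))\frac{\xi_t}{\pi_t(X_t)},\qquad \hat\theta_n=\frac1n\sum_{t=1}^n\Delta_t,\qquad \sigma_t^2=V(f_t,\pi_t)=\mathrm{Var}(\Delta_t\mid f_t,\pi_t).$$ Suppose that $\frac1n\sum_{t=1}^n\sigma_t^2\to\sigma_*^2=V(f_*,\pi_*)$ in probability for some fixed model--rule pair $(f_*,\pi_*)$, and that the Lindeberg condition holds: for every $\epsilon>0$, $$\frac1n\sum_{t=1}^n\mathbb E\big[(\Delta_t-\theta^*)^2\,\mathbf 1\{|\Delta_t-\theta^*|>\epsilon\sqrt n\}\,\big|\,\mathcal F_{t-1}\big]\to0\quad\text{in probability}.$$ Then $\sqrt n(\hat\theta_n-\theta^*)$ converges in distribution to $\mathcal N(0,\sigma_*^2)$ (the point mass at $0$ if $\sigma_*^2=0$). Consequently, if $\sigma_*^2>0$, then for all estimates $\hat\sigma_n^2$ that converge to $\sigma_*^2$ in probability and every $\alpha\in(0,1)$, the interval $\mathcal C_\alpha=\big[\hat\theta_n- z_{1-\alpha/2}\hat\sigma_n/\sqrt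 n,\ \hat\theta_n+ z_{1-\alpha/2}\hat\sigma_n/\sqrt n\big]$, with $z_q$ the $q$-th quantile of $\mathcal N(0,1)$, satisfies $\lim_{n\to\infty}\mathbb P(\theta^*\in\mathcal C_\alpha)=1-\alpha$. -/

import Mathlib

open MeasureTheory ProbabilityTheory Filter Topology
open scoped ENNReal unitInterval

namespace ActiveInference

/-- The increment `f(x) + (y - f(x)) ξ / π(x)` contributed by a point `(x, y)` with labelling
decision `ξ ∈ {0, 1}`, for a model `f` and a sampling rule `π`. -/
noncomputable def increment {𝒳 : Type*} (f : 𝒳 → ℝ) (π : 𝒳 → I) (x : 𝒳) (y ξ : ℝ) : ℝ :=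
  f x + (y - f x) * (ξ / (π x : ℝ))

/-- The increment of a fixed pair `(f, π)` at a generic point: `((x, y), u)` with `(x, y) ∼ P` and
an independent `u` uniform on `[0, 1]`; the decision `ξ = 1{u ≤ π(x)}` is `Bern(π(x))`
given `(x, y)`. -/
noncomputable def genericIncrement {𝒳 : Type*} (f : 𝒳 → ℝ) (π : 𝒳 → I) (p : (𝒳 × ℝ) × I) : ℝ :=
  increment f π p.1.1 p.1.2 ({u : I | u ≤ π p.1.1}.indicator (fun _ => (1 : ℝ)) p.2)

/-- The functional `V(f, π) = Var(f(X) + (Y - f(X)) ξ / π(X))`, where `(X, Y) ∼ P` and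
`ξ ∼ Bern(π(X))`. -/
noncomputable def V {𝒳 : Type*} [MeasurableSpace 𝒳] (P : Measure (𝒳 × ℝ))
    (f : 𝒳 → ℝ) (π : 𝒳 → I) : ℝ :=
  Var[genericIncrement f π; P.prod (volume : Measure I)]

/-- A model `f` and a sampling rule `π` for which the increment is well defined (labels are sampled
with positive probability, except possibly at points that the model labels correctly) and has
finite variance. -/
structure IsModelRulePair {𝒳 : Type*} [MeasurableSpace 𝒳] (P : Measure (𝒳 × ℝ))
    (f : 𝒳 → ℝ) (π : 𝒳 → I) : Prop where
  measurable_model : Measurable f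
  measurable_rule : Measurable π
  pos_or_correct : ∀ᵐ p ∂P, 0 < π p.1 ∨ p.2 = f p.1
  finite_variance : MemLp (genericIncrement f π) 2 (P.prod (volume : Measure I))

/-- The `σ`-algebra generated by the first `t` observations `(X_s, Y_s ξ_s, ξ_s)`, `s < t`
(time is counted from `0`); this is what is known just before the point with index `t`. -/
@[reducible] def history {Ω 𝒳 : Type*} [MeasurableSpace 𝒳] (X : ℕ → Ω → 𝒳) (Y ξ : ℕ → Ω → ℝ) (t : ℕ) :
    MeasurableSpace Ω :=
  ⨆ s < t, MeasurableSpace.comap (fun ω => (X s ω, Y s ω * ξ s ω, ξ s ω)) inferInstance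

/-- Sequential active data collection over `n` points with indices `t < n`. -/
structure IsSequentialScheme {Ω 𝒳 : Type*} [MeasurableSpace Ω] [MeasurableSpace 𝒳]
    (μ : Measure Ω) (P : Measure (𝒳 × ℝ)) (n : ℕ)
    (X : ℕ → Ω → 𝒳) (Y ξ : ℕ → Ω → ℝ) (f : ℕ → Ω → 𝒳 → ℝ) (π : ℕ → Ω → 𝒳 → I) : Prop where
  measurable_X : ∀ t < n, Measurable (X t)
  measurable_Y : ∀ t < n, Measurable (Y t)
  measurable_ξ : ∀ t < n, Measurable (ξ t)
  /-- The pairs `(X_t, Y_t)` are distributed as `P` ... -/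
  law : ∀ t < n, μ.map (fun ω => (X t ω, Y t ω)) = P
  /-- ... and independent. -/
  indep : iIndepFun (fun (t : Fin n) ω => (X t ω, Y t ω)) μ
  /-- A new point is independent of what has been observed before. -/
  fresh : ∀ t < n, Indep (MeasurableSpace.comap (fun ω => (X t ω, Y t ω)) inferInstance)
    (history X Y ξ t) μ
  /-- The model and the sampling rule are determined by what has been observed before. -/
  predictable_model : ∀ t < n, Measurable[(history X Y ξ t).prod inferInstance]
    (fun p : Ω × 𝒳 => f t p.1 p.2)
  predictable_rule : ∀ t < n, Measurable[(history X Y ξ t).prod inferInstance]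
    (fun p : Ω × 𝒳 => π t p.1 p.2)
  /-- Given the past observations and the new point, the label is collected with probability
  `π_t(X_t)`. -/
  decision : ∀ t < n, ∀ ω, ξ t ω = 0 ∨ ξ t ω = 1
  bernoulli : ∀ t < n,
    μ[ξ t | history X Y ξ t ⊔ MeasurableSpace.comap (fun ω => (X t ω, Y t ω)) inferInstance]
      =ᵐ[μ] fun ω => (π t ω (X t ω) : ℝ)
  /-- The increments are well defined, with finite conditional variance. -/
  pair : ∀ t < n, ∀ᵐ ω ∂μ, IsModelRulePair P (f t ω) (π t ω)

/-- The increment `Δ_t = f_t(X_t) + (Y_t - f_t(X_t)) ξ_t / π_t(X_t)`. -/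
noncomputable def Δ {Ω 𝒳 : Type*} (X : ℕ → Ω → 𝒳) (Y ξ : ℕ → Ω → ℝ)
    (f : ℕ → Ω → 𝒳 → ℝ) (π : ℕ → Ω → 𝒳 → I) (t : ℕ) (ω : Ω) : ℝ :=
  increment (f t ω) (π t ω) (X t ω) (Y t ω) (ξ t ω)

/-- The sequential active mean estimator, the average of the first `n` increments. -/
noncomputable def estimator {Ω 𝒳 : Type*} (n : ℕ) (X : ℕ → Ω → 𝒳) (Y ξ : ℕ → Ω → ℝ)
    (f : ℕ → Ω → 𝒳 → ℝ) (π : ℕ → Ω → 𝒳 → I) (ω : Ω) : ℝ :=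
  (n : ℝ)⁻¹ * ∑ t ∈ Finset.range n, Δ X Y ξ f π t ω

/-- The conditional Lindeberg sum
`(1/n) ∑ₜ E[(Δ_t - θ)² 1{|Δ_t - θ| > ε √n} | past]`, as a `[0, ∞]`-valued random variable. -/
noncomputable def lindebergSum {Ω 𝒳 : Type*} [MeasurableSpace Ω] [MeasurableSpace 𝒳]
    (μ : Measure Ω) (θ ε : ℝ) (n : ℕ) (X : ℕ → Ω → 𝒳) (Y ξ : ℕ → Ω → ℝ)
    (f : ℕ → Ω → 𝒳 → ℝ) (π : ℕ → Ω → 𝒳 → I) (ω : Ω) : ℝ≥0∞ :=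
  (n : ℝ≥0∞)⁻¹ * ∑ t ∈ Finset.range n,
    condLExp (history X Y ξ t) μ
      ({ω' | ε * √(n : ℝ) < |Δ X Y ξ f π t ω' - θ|}.indicator
        fun ω' => ENNReal.ofReal ((Δ X Y ξ f π t ω' - θ) ^ 2)) ω

/-- The `q`-th quantile `z_q` of the standard normal distribution. -/
noncomputable def stdNormalQuantile (q : ℝ) : ℝ := sInf {x : ℝ | q ≤ cdf (gaussianReal 0 1) x}

end ActiveInference

/-!
The centred increments `Δ t - θ` are martingale differences: inverse probability weighting makes
each increment unbiased whatever the current model and rule are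
(`IsModelRulePair.integral_genericIncrement`). Hence the first claim is a martingale central limit
theorem and the second follows from it by Slutsky's theorem.

*Conditional laws.* The new point is independent of the history, and the decision is Bernoulli given
both, so the triple (history, point, decision) has the law obtained by drawing history, point and a
uniform threshold independently (`map_past_point_decision`). Thus the conditional law of `Δ t` given
the history is the law of the generic increment of the frozen pair
(`IsSequentialScheme.hasCondLaw`). All conditional moments are then computed by Fubini; in
particular the conditional variance is `V P (f t ω) (π t ω)`.

*Stopping.* The conditional variances are almost surely finite, but they need not be integrable, and
neither need the increments be. Each increment is therefore multiplied by a weight, known from the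
past, that vanishes once the accumulated conditional variance exceeds `(σ² + 1) n`, where
`σ² = V P fstar πstar`. The stopped array
consists of square integrable martingale differences whose conditional variances sum to at most
`σ² + 1` (`IsSequentialScheme.isMartingaleDiff`), and it differs from the original one only on an
event of vanishing probability (`IsSequentialScheme.stopped_sums_ae_eq`). Being bounded by `σ² + 1`,
its conditional Lindeberg sum tends to zero in mean and not only in probability
(`IsSequentialScheme.sum_integral_tailSq_le`).

*Central limit theorem.* For differences `D t` with conditional variances `v t`, the products
`exp (i u ∑ D) exp (u² ∑ v / 2)` have expectations that change little from one step to the next,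
since `exp (i u D)` and `exp (- u² v / 2)` have the same conditional second order expansion
(`norm_integral_mul_exp_sub_exp_le`). Telescoping shows that the expectation of the full product
tends to `1`; as `∑ v` converges to the constant `σ²`, the characteristic function of `∑ D`
converges to `exp (- u² σ² / 2)`, and Lévy's theorem applies
(`tendstoInDistribution_sum_of_isMartingaleDiff`).
-/

namespace ActiveInference

/-! ### Second order estimates for one martingale difference -/

/-- The square of `d`, cut off to `0` where `|d| ≤ ε`. -/
noncomputable def tailSq (ε d : ℝ) : ℝ := if ε < |d| then d ^ 2 else 0

lemma tailSq_nonneg (ε d : ℝ) : 0 ≤ tailSq ε d := by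
  unfold tailSq; split_ifs <;> positivity

lemma tailSq_le_sq (ε d : ℝ) : tailSq ε d ≤ d ^ 2 := by
  unfold tailSq; split_ifs
  · exact le_rfl
  · positivity

lemma sq_le_add_tailSq (ε d : ℝ) : d ^ 2 ≤ ε ^ 2 + tailSq ε d := by
  unfold tailSq; split_ifs with h
  · nlinarith [sq_nonneg ε]
  · rw [add_zero]; exact sq_le_sq' (by linarith [neg_abs_le d]) (by linarith [le_abs_self d])

lemma measurable_tailSq (ε : ℝ) : Measurable (tailSq ε) :=
  Measurable.ite (measurableSet_lt measurable_const measurable_norm)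
    (measurable_id.pow_const 2) measurable_const

lemma integrable_tailSq {Ω : Type*} {mΩ : MeasurableSpace Ω} {μ : Measure Ω} {D : Ω → ℝ}
    (hD : MemLp D 2 μ) (ε : ℝ) : Integrable (fun ω => tailSq ε (D ω)) μ := by
  refine hD.integrable_sq.mono
    ((measurable_tailSq ε).comp_aemeasurable hD.aemeasurable).aestronglyMeasurable
    (ae_of_all _ fun ω => ?_)
  rw [Real.norm_of_nonneg (tailSq_nonneg _ _), Real.norm_of_nonneg (sq_nonneg _)]
  exact tailSq_le_sq _ _

/-- The remainder of the second order expansion of `exp (i x)` at `0`. -/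
noncomputable def expRem (x : ℝ) : ℂ :=
  Complex.exp (x * Complex.I) - 1 - x * Complex.I + x ^ 2 / 2

lemma continuous_expRem : Continuous expRem := by unfold expRem; fun_prop

lemma norm_expRem_le_cube {x : ℝ} (hx : |x| ≤ 1) : ‖expRem x‖ ≤ |x| ^ 3 := by
  have h := Complex.exp_bound (x := x * Complex.I) (by simpa using hx) (n := 3) (by norm_num)
  have hI : (x * Complex.I) ^ 2 = -(x : ℂ) ^ 2 := by rw [mul_pow, Complex.I_sq]; ring
  have e : expRem x = Complex.exp (x * Complex.I) -
      ∑ m ∈ Finset.range 3, (x * Complex.I) ^ m / (m.factorial : ℂ) := by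
    simp only [Finset.sum_range_succ, Finset.sum_range_zero, hI, expRem]
    norm_num [Nat.factorial]
    ring
  rw [e]
  refine h.trans ?_
  have : ‖(x : ℂ) * Complex.I‖ = |x| := by simp
  rw [this]
  refine mul_le_of_le_one_right (by positivity) ?_
  norm_num [Nat.factorial]

lemma norm_expRem_le_sq (x : ℝ) : ‖expRem x‖ ≤ 4 * x ^ 2 := by
  rcases le_total |x| 1 with hx | hx
  · refine (norm_expRem_le_cube hx).trans ?_
    rw [← sq_abs x]
    nlinarith [mul_le_mul_of_nonneg_left hx (sq_nonneg |x|), sq_nonneg |x|]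
  · have h1 : ‖expRem x‖ ≤ 1 + 1 + |x| + |x| ^ 2 / 2 := by
      unfold expRem
      refine (norm_add_le _ _).trans (add_le_add ((norm_sub_le _ _).trans
        (add_le_add ((norm_sub_le _ _).trans (add_le_add ?_ ?_)) ?_)) ?_)
      · rw [Complex.norm_exp_ofReal_mul_I]
      · simp
      · simp
      · simp
    rw [← sq_abs x]
    nlinarith

/-- The form of the Taylor estimate used with the Lindeberg condition: a small multiple of `d ^ 2`,
up to the contribution of large `d`. -/
lemma norm_expRem_mul_le {u ε : ℝ} (hε : 0 ≤ ε) (hu : |u| * ε ≤ 1) (d : ℝ) :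
    ‖expRem (u * d)‖ ≤ |u| ^ 3 * ε * d ^ 2 + 4 * u ^ 2 * tailSq ε d := by
  unfold tailSq; split_ifs with h
  · have := norm_expRem_le_sq (u * d)
    have h0 : 0 ≤ |u| ^ 3 * ε * d ^ 2 := by positivity
    nlinarith
  · push Not at h
    have h1 : |u * d| ≤ 1 := by
      rw [abs_mul]; exact (mul_le_mul_of_nonneg_left h (abs_nonneg u)).trans hu
    refine (norm_expRem_le_cube h1).trans ?_
    have : |d| ^ 2 * |d| ≤ |d| ^ 2 * ε := by gcongr
    rw [abs_mul, mul_zero, add_zero, ← sq_abs d]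
    calc (|u| * |d|) ^ 3 = |u| ^ 3 * (|d| ^ 2 * |d|) := by ring
      _ ≤ |u| ^ 3 * (|d| ^ 2 * ε) := by gcongr
      _ = _ := by ring

lemma abs_exp_neg_sub_le {x : ℝ} (hx : 0 ≤ x) : |Real.exp (-x) - 1 + x| ≤ x ^ 2 := by
  have h1 := Real.one_sub_le_exp_neg x
  have h2 : Real.exp (-x) ≤ 1 - x + x ^ 2 := by
    have h3 := Real.add_one_le_exp x
    have h4 : Real.exp (-x) * Real.exp x = 1 := by rw [← Real.exp_add]; simp
    have h5 : 0 < Real.exp (-x) := Real.exp_pos _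
    have h6 : Real.exp (-x) * (1 + x) ≤ 1 := by nlinarith
    have h7 : 0 ≤ x ^ 3 := by positivity
    by_contra hc
    push Not at hc
    nlinarith
  rw [abs_le]; constructor <;> nlinarith [sq_nonneg x]

section Martingale

variable {Ω : Type*} {m mΩ : MeasurableSpace Ω} {μ : Measure Ω} [IsProbabilityMeasure μ]

lemma integral_smul_eq_of_condExp (hm : m ≤ mΩ) {D v : Ω → ℝ} {W : Ω → ℂ} {K : ℝ}
    (hD : Integrable D μ) (hv : μ[D|m] =ᵐ[μ] v)
    (hW : StronglyMeasurable[m] W) (hWK : ∀ ω, ‖W ω‖ ≤ K) :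
    ∫ ω, D ω • W ω ∂μ = ∫ ω, v ω • W ω ∂μ := by
  have hi : Integrable (D • W) μ :=
    hD.smul_bdd K (hW.mono hm).aestronglyMeasurable (ae_of_all _ hWK)
  have h := condExp_smul_of_aestronglyMeasurable_right (m := m) hD hi hW.aestronglyMeasurable
  have h2 := integral_condExp (μ := μ) (f := D • W) hm
  rw [integral_congr_ae h] at h2
  rw [show (∫ ω, D ω • W ω ∂μ) = ∫ ω, (D • W) ω ∂μ from rfl, ← h2]
  refine integral_congr_ae ?_
  filter_upwards [hv] with ω hω
  simp [hω]

lemma integral_mul_eq_of_condExp (hm : m ≤ mΩ) {D v W : Ω → ℝ} {K : ℝ}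
    (hD : Integrable D μ) (hv : μ[D|m] =ᵐ[μ] v)
    (hW : StronglyMeasurable[m] W) (hWK : ∀ ω, ‖W ω‖ ≤ K) :
    ∫ ω, W ω * D ω ∂μ = ∫ ω, W ω * v ω ∂μ := by
  have hi : Integrable (W * D) μ :=
    hD.bdd_mul (c := K) (hW.mono hm).aestronglyMeasurable (ae_of_all _ hWK)
  have h := condExp_mul_of_stronglyMeasurable_left (m := m) hW hi hD
  have h2 := integral_condExp (μ := μ) (f := W * D) hm
  rw [integral_congr_ae h] at h2
  rw [show (∫ ω, W ω * D ω ∂μ) = ∫ ω, (W * D) ω ∂μ from rfl, ← h2]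
  refine integral_congr_ae ?_
  filter_upwards [hv] with ω hω
  simp [hω]

/-- A martingale difference `D` with conditional variance `v` has nearly the conditional
characteristic function of a Gaussian variable of variance `v`. -/
lemma norm_integral_mul_exp_sub_exp_le (hm : m ≤ mΩ) {D v : Ω → ℝ} {W : Ω → ℂ} {K C u ε : ℝ}
    (hD : MemLp D 2 μ) (hmean : μ[D|m] =ᵐ[μ] 0) (hvar : μ[fun ω => D ω ^ 2|m] =ᵐ[μ] v)
    (hv : Measurable[m] v) (hv0 : ∀ ω, 0 ≤ v ω) (hvC : ∀ ω, v ω ≤ C)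
    (hW : StronglyMeasurable[m] W) (hWK : ∀ ω, ‖W ω‖ ≤ K)
    (hε : 0 ≤ ε) (hu : |u| * ε ≤ 1) :
    ‖∫ ω, W ω * (Complex.exp ((u * D ω : ℝ) * Complex.I)
        - (Real.exp (-(u ^ 2 * v ω / 2)) : ℝ)) ∂μ‖
      ≤ K * ((|u| ^ 3 * ε + u ^ 4 * ε ^ 2) * ∫ ω, v ω ∂μ
        + (4 * u ^ 2 + u ^ 4 * C) * ∫ ω, tailSq ε (D ω) ∂μ) := by
  have hDi : Integrable D μ := hD.integrable (by norm_num)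
  have hD2 : Integrable (fun ω => D ω ^ 2) μ := hD.integrable_sq
  have hT := integrable_tailSq hD ε
  have hvm : Measurable v := hv.mono hm le_rfl
  have hWm : AEStronglyMeasurable W μ := (hW.mono hm).aestronglyMeasurable
  obtain ⟨ω₀⟩ : Nonempty Ω := nonempty_of_isProbabilityMeasure μ
  have hK : 0 ≤ K := (norm_nonneg _).trans (hWK ω₀)
  have hvb : ∀ ω, ‖v ω‖ ≤ C := fun ω => by rw [Real.norm_of_nonneg (hv0 ω)]; exact hvC ω
  have hvi : Integrable v μ := .of_bound hvm.aestronglyMeasurable C (ae_of_all _ hvb)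
  have hv2 : Integrable (fun ω => v ω ^ 2) μ :=
    .of_bound (hvm.pow_const 2).aestronglyMeasurable (C ^ 2) (ae_of_all _ fun ω => by
      rw [norm_pow]; exact pow_le_pow_left₀ (norm_nonneg _) (hvb ω) 2)
  have hEv : ∫ ω, D ω ^ 2 ∂μ = ∫ ω, v ω ∂μ := by
    rw [← integral_condExp hm, integral_congr_ae hvar]
  have hEv2 : ∫ ω, v ω ^ 2 ∂μ ≤ ε ^ 2 * ∫ ω, v ω ∂μ + C * ∫ ω, tailSq ε (D ω) ∂μ := by
    have h := integral_mul_eq_of_condExp hm hD2 hvar hv.stronglyMeasurable hvb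
    calc ∫ ω, v ω ^ 2 ∂μ = ∫ ω, v ω * D ω ^ 2 ∂μ := by rw [h]; simp [sq]
      _ ≤ ∫ ω, (ε ^ 2 * v ω + C * tailSq ε (D ω)) ∂μ := by
        refine integral_mono (hD2.bdd_mul (c := C) hvm.aestronglyMeasurable (ae_of_all _ hvb))
          ((hvi.const_mul _).add (hT.const_mul _)) fun ω => ?_
        have h1 := mul_le_mul_of_nonneg_left (sq_le_add_tailSq ε (D ω)) (hv0 ω)
        have h2 := mul_le_mul_of_nonneg_right (hvC ω) (tailSq_nonneg ε (D ω))
        simp only; linarith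
      _ = _ := by
        rw [integral_add (hvi.const_mul _) (hT.const_mul _), integral_const_mul,
          integral_const_mul]
  have hDm := hD.aestronglyMeasurable
  -- the integrand is split into two Taylor remainders and two terms that integrate to zero
  set A : Ω → ℂ := fun ω => W ω * expRem (u * D ω) with hA
  set B : Ω → ℂ := fun ω => W ω * ((Real.exp (-(u ^ 2 * v ω / 2)) - 1 + u ^ 2 * v ω / 2 : ℝ) : ℂ)
    with hB
  set E : Ω → ℂ := fun ω => (D ω) • (W ω * (u * Complex.I)) with hE
  set F : Ω → ℂ := fun ω => (D ω ^ 2) • (W ω * (u ^ 2 / 2)) with hF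
  set G : Ω → ℂ := fun ω => (v ω) • (W ω * (u ^ 2 / 2)) with hG
  have hAn : ∀ ω, ‖A ω‖ ≤ K * (|u| ^ 3 * ε * D ω ^ 2 + 4 * u ^ 2 * tailSq ε (D ω)) := fun ω => by
    rw [hA]; simp only [norm_mul]
    exact mul_le_mul (hWK ω) (norm_expRem_mul_le hε hu _) (norm_nonneg _) hK
  have hBn : ∀ ω, ‖B ω‖ ≤ K * (u ^ 4 / 4 * v ω ^ 2) := fun ω => by
    rw [hB]; simp only [norm_mul]
    refine mul_le_mul (hWK ω) ?_ (norm_nonneg _) hK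
    rw [Complex.norm_real, Real.norm_eq_abs]
    refine (abs_exp_neg_sub_le (by have := hv0 ω; positivity)).trans (le_of_eq (by ring))
  have iAb : Integrable
      (fun ω => K * (|u| ^ 3 * ε * D ω ^ 2 + 4 * u ^ 2 * tailSq ε (D ω))) μ :=
    ((hD2.const_mul _).add (hT.const_mul _)).const_mul _
  have iBb : Integrable (fun ω => K * (u ^ 4 / 4 * v ω ^ 2)) μ := (hv2.const_mul _).const_mul _
  have iA : Integrable A μ := by
    refine iAb.mono' (hWm.mul (continuous_expRem.comp_aestronglyMeasurable
      (hDm.const_mul u))) (ae_of_all _ hAn)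
  have iB : Integrable B μ := by
    refine iBb.mono' (hWm.mul (Measurable.aestronglyMeasurable (by fun_prop))) (ae_of_all _ hBn)
  have hb1 : ∀ ω, ‖W ω * (u * Complex.I)‖ ≤ K * ‖(u * Complex.I : ℂ)‖ := fun ω => by
    rw [norm_mul]; exact mul_le_mul_of_nonneg_right (hWK ω) (norm_nonneg _)
  have hb2 : ∀ ω, ‖W ω * (u ^ 2 / 2)‖ ≤ K * ‖(u ^ 2 / 2 : ℂ)‖ := fun ω => by
    rw [norm_mul]; exact mul_le_mul_of_nonneg_right (hWK ω) (norm_nonneg _)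
  have iE : Integrable E μ :=
    hDi.smul_bdd _ (hWm.mul_const _) (ae_of_all _ hb1)
  have iF : Integrable F μ :=
    hD2.smul_bdd _ (hWm.mul_const _) (ae_of_all _ hb2)
  have iG : Integrable G μ :=
    hvi.smul_bdd _ (hWm.mul_const _) (ae_of_all _ hb2)
  have hE0 : ∫ ω, E ω ∂μ = 0 := by
    rw [hE, integral_smul_eq_of_condExp hm hDi hmean (hW.mul_const _) hb1]; simp
  have hFG : ∫ ω, F ω ∂μ = ∫ ω, G ω ∂μ :=
    integral_smul_eq_of_condExp hm hD2 hvar (hW.mul_const _) hb2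
  have hsplit : ∀ ω, W ω * (Complex.exp ((u * D ω : ℝ) * Complex.I)
        - (Real.exp (-(u ^ 2 * v ω / 2)) : ℝ)) = A ω - B ω + E ω - (F ω - G ω) := fun ω => by
    simp only [hA, hB, hE, hF, hG, expRem, Complex.real_smul]
    push_cast
    ring
  have hint : ∫ ω, W ω * (Complex.exp ((u * D ω : ℝ) * Complex.I)
        - (Real.exp (-(u ^ 2 * v ω / 2)) : ℝ)) ∂μ = ∫ ω, A ω ∂μ - ∫ ω, B ω ∂μ := by
    simp_rw [hsplit]
    have e1 := integral_sub ((iA.sub iB).add iE) (iF.sub iG)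
    have e2 := integral_add (iA.sub iB) iE
    simp only [Pi.add_apply, Pi.sub_apply] at e1 e2
    rw [e1, e2, integral_sub iA iB, integral_sub iF iG, hE0, hFG]
    ring
  rw [hint]
  have nA : ‖∫ ω, A ω ∂μ‖ ≤
      K * (|u| ^ 3 * ε * ∫ ω, v ω ∂μ + 4 * u ^ 2 * ∫ ω, tailSq ε (D ω) ∂μ) := by
    refine (norm_integral_le_of_norm_le iAb (ae_of_all _ hAn)).trans (le_of_eq ?_)
    rw [integral_const_mul, integral_add (hD2.const_mul _) (hT.const_mul _), integral_const_mul,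
      integral_const_mul, hEv]
  have nB : ‖∫ ω, B ω ∂μ‖ ≤ K * (u ^ 4 / 4 * ∫ ω, v ω ^ 2 ∂μ) := by
    refine (norm_integral_le_of_norm_le iBb (ae_of_all _ hBn)).trans (le_of_eq ?_)
    rw [integral_const_mul, integral_const_mul]
  have hv2' : 0 ≤ ∫ ω, v ω ^ 2 ∂μ := integral_nonneg fun ω => sq_nonneg _
  have nB' : u ^ 4 / 4 * ∫ ω, v ω ^ 2 ∂μ ≤
      u ^ 4 * (ε ^ 2 * ∫ ω, v ω ∂μ + C * ∫ ω, tailSq ε (D ω) ∂μ) := by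
    calc u ^ 4 / 4 * ∫ ω, v ω ^ 2 ∂μ ≤ u ^ 4 * ∫ ω, v ω ^ 2 ∂μ := by
          refine mul_le_mul_of_nonneg_right ?_ hv2'
          have : 0 ≤ u ^ 4 := by positivity
          linarith
      _ ≤ _ := mul_le_mul_of_nonneg_left hEv2 (by positivity)
  calc ‖∫ ω, A ω ∂μ - ∫ ω, B ω ∂μ‖ ≤ ‖∫ ω, A ω ∂μ‖ + ‖∫ ω, B ω ∂μ‖ := norm_sub_le _ _
    _ ≤ _ := add_le_add nA (nB.trans (mul_le_mul_of_nonneg_left nB' hK))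
    _ = _ := by ring

end Martingale

/-! ### The martingale central limit theorem -/

section Martingale

variable {Ω : Type*} {mΩ : MeasurableSpace Ω} {μ : Measure Ω}

/-- A finite sequence `D 0, …, D (n - 1)` of square integrable martingale differences for the
`σ`-algebras `ℱ t`, with conditional variances `v t` whose sum is at most the constant `C`. Only
the indices up to `n` are constrained. -/
structure IsMartingaleDiff (μ : Measure Ω) (n : ℕ) (ℱ : ℕ → MeasurableSpace Ω)
    (D v : ℕ → Ω → ℝ) (C : ℝ) : Prop where
  mono : Monotone ℱ
  le : ∀ t ≤ n, ℱ t ≤ mΩ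
  adapted : ∀ t < n, Measurable[ℱ (t + 1)] (D t)
  memLp : ∀ t < n, MemLp (D t) 2 μ
  condExp_eq_zero : ∀ t < n, μ[D t|ℱ t] =ᵐ[μ] 0
  condExp_sq : ∀ t < n, μ[fun ω => D t ω ^ 2|ℱ t] =ᵐ[μ] v t
  predictable : ∀ t < n, Measurable[ℱ t] (v t)
  nonneg : ∀ t < n, ∀ ω, 0 ≤ v t ω
  sum_le : ∀ ω, ∑ t ∈ Finset.range n, v t ω ≤ C

variable {n : ℕ} {ℱ : ℕ → MeasurableSpace Ω} {D v : ℕ → Ω → ℝ} {C : ℝ}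

lemma IsMartingaleDiff.sum_le_of_le (h : IsMartingaleDiff μ n ℱ D v C) {k : ℕ} (hk : k ≤ n)
    (ω : Ω) : ∑ t ∈ Finset.range k, v t ω ≤ C :=
  (Finset.sum_le_sum_of_subset_of_nonneg (Finset.range_mono hk) fun t ht _ =>
    h.nonneg t (Finset.mem_range.1 ht) ω).trans (h.sum_le ω)

lemma IsMartingaleDiff.measurable_sum (h : IsMartingaleDiff μ n ℱ D v C) {k : ℕ} (hk : k ≤ n) :
    Measurable[ℱ k] fun ω => ∑ t ∈ Finset.range k, D t ω :=
  Finset.measurable_sum _ fun t ht => by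
    have ht := Finset.mem_range.1 ht
    exact (h.adapted t (by omega)).mono (h.mono (by omega)) le_rfl

lemma IsMartingaleDiff.measurable_sum_var (h : IsMartingaleDiff μ n ℱ D v C) {k : ℕ}
    (hk : k < n) : Measurable[ℱ k] fun ω => ∑ t ∈ Finset.range (k + 1), v t ω :=
  Finset.measurable_sum _ fun t ht => by
    have ht := Finset.mem_range.1 ht
    exact (h.predictable t (by omega)).mono (h.mono (by omega)) le_rfl

/-- With the random normalization `exp (u² ∑ v / 2)`, the characteristic function of the sum is
close to `1`, with an error controlled by the Lindeberg sum. The partial products telescope, and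
each step is an instance of `norm_integral_mul_exp_sub_exp_le`. -/
lemma IsMartingaleDiff.norm_integral_exp_sub_one_le [IsProbabilityMeasure μ]
    (h : IsMartingaleDiff μ n ℱ D v C)
    {u ε : ℝ} (hε : 0 ≤ ε) (hu : |u| * ε ≤ 1) :
    ‖∫ ω, Complex.exp ((u * ∑ t ∈ Finset.range n, D t ω : ℝ) * Complex.I) *
        (Real.exp (u ^ 2 * (∑ t ∈ Finset.range n, v t ω) / 2) : ℝ) ∂μ - 1‖
      ≤ Real.exp (u ^ 2 * C / 2) * ((|u| ^ 3 * ε + u ^ 4 * ε ^ 2) * C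
        + (4 * u ^ 2 + u ^ 4 * C) *
          ∑ t ∈ Finset.range n, ∫ ω, tailSq ε (D t ω) ∂μ) := by
  set S : ℕ → Ω → ℝ := fun k ω => ∑ t ∈ Finset.range k, D t ω with hS
  set s : ℕ → Ω → ℝ := fun k ω => ∑ t ∈ Finset.range k, v t ω with hs
  set K := Real.exp (u ^ 2 * C / 2)
  set T : ℕ → Ω → ℂ := fun k ω => Complex.exp ((u * S k ω : ℝ) * Complex.I) *
        (Real.exp (u ^ 2 * s k ω / 2) : ℝ) with hT
  have hbound : ∀ k ≤ n, ∀ x : ℝ, ∀ ω, ‖Complex.exp ((x : ℝ) * Complex.I) *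
        (Real.exp (u ^ 2 * s k ω / 2) : ℝ)‖ ≤ K := fun k hk x ω => by
    rw [norm_mul, Complex.norm_exp_ofReal_mul_I, one_mul, Complex.norm_real,
      Real.norm_of_nonneg (Real.exp_pos _).le]
    have := h.sum_le_of_le hk ω
    exact Real.exp_le_exp.2 (by gcongr)
  have hSm : ∀ k ≤ n, Measurable (S k) := fun k hk => (h.measurable_sum hk).mono (h.le k hk) le_rfl
  have hvm : ∀ t < n, Measurable (v t) := fun t ht =>
    (h.predictable t ht).mono (h.le t ht.le) le_rfl
  have hsm : ∀ k ≤ n, Measurable (s k) := fun k hk =>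
    Finset.measurable_sum _ fun t ht => hvm t ((Finset.mem_range.1 ht).trans_le hk)
  have hTi : ∀ k ≤ n, Integrable (T k) μ := fun k hk => by
    refine .of_bound (Measurable.aestronglyMeasurable ?_) K
      (ae_of_all _ fun ω => hbound k hk _ ω)
    have := hSm k hk
    have := hsm k hk
    fun_prop
  have hstep : ∀ k < n, ‖∫ ω, T (k + 1) ω ∂μ - ∫ ω, T k ω ∂μ‖ ≤
      K * ((|u| ^ 3 * ε + u ^ 4 * ε ^ 2) * ∫ ω, v k ω ∂μ
        + (4 * u ^ 2 + u ^ 4 * C) * ∫ ω, tailSq ε (D k ω) ∂μ) := fun k hk => by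
    rw [← integral_sub (hTi _ hk) (hTi _ hk.le)]
    have hvC : ∀ ω, v k ω ≤ C := fun ω => by
      refine le_trans ?_ (h.sum_le_of_le hk ω)
      rw [Finset.sum_range_succ]
      exact le_add_of_nonneg_left (Finset.sum_nonneg fun t ht =>
        h.nonneg t ((Finset.mem_range.1 ht).trans hk) ω)
    have hWm : Measurable[ℱ k] fun ω => Complex.exp ((u * S k ω : ℝ) * Complex.I) *
        (Real.exp (u ^ 2 * s (k + 1) ω / 2) : ℝ) := by
      have h1 : Measurable[ℱ k] (S k) := h.measurable_sum hk.le
      have h2 : Measurable[ℱ k] (s (k + 1)) := h.measurable_sum_var hk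
      fun_prop
    have := norm_integral_mul_exp_sub_exp_le (h.le k hk.le) (h.memLp k hk)
      (h.condExp_eq_zero k hk) (h.condExp_sq k hk) (h.predictable k hk) (h.nonneg k hk) hvC
      hWm.stronglyMeasurable (fun ω => hbound (k + 1) hk _ ω) hε hu
    convert this using 4 with ω
    have e1 : S (k + 1) ω = S k ω + D k ω := Finset.sum_range_succ _ _
    have e2 : s (k + 1) ω = s k ω + v k ω := Finset.sum_range_succ _ _
    have e3 : Real.exp (u ^ 2 * s (k + 1) ω / 2) * Real.exp (-(u ^ 2 * v k ω / 2)) =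
        Real.exp (u ^ 2 * s k ω / 2) := by
      rw [← Real.exp_add, e2]; congr 1; ring
    have e4 : Complex.exp ((u * S (k + 1) ω : ℝ) * Complex.I) =
        Complex.exp ((u * S k ω : ℝ) * Complex.I) *
          Complex.exp ((u * D k ω : ℝ) * Complex.I) := by
      rw [← Complex.exp_add, e1]; congr 1; push_cast; ring
    simp only [hT]
    rw [e4, ← e3]
    push_cast
    ring
  have hT0 : ∫ ω, T 0 ω ∂μ = 1 := by simp [hT, hS, hs]
  have htel : ∫ ω, T n ω ∂μ - 1 =
      ∑ k ∈ Finset.range n, (∫ ω, T (k + 1) ω ∂μ - ∫ ω, T k ω ∂μ) := by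
    rw [Finset.sum_range_sub (fun k => ∫ ω, T k ω ∂μ), hT0]
  have hvi : ∀ t < n, Integrable (v t) μ := fun t ht =>
    integrable_condExp.congr (h.condExp_sq t ht)
  have hvsum : ∑ t ∈ Finset.range n, ∫ ω, v t ω ∂μ ≤ C := by
    rw [← integral_finsetSum _ fun t ht => hvi t (Finset.mem_range.1 ht)]
    calc ∫ ω, ∑ t ∈ Finset.range n, v t ω ∂μ ≤ ∫ _, C ∂μ :=
          integral_mono (integrable_finsetSum _ fun t ht => hvi t (Finset.mem_range.1 ht))
            (integrable_const _) h.sum_le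
      _ = C := by simp
  have : ‖∫ ω, T n ω ∂μ - 1‖ ≤ ∑ k ∈ Finset.range n,
      K * ((|u| ^ 3 * ε + u ^ 4 * ε ^ 2) * ∫ ω, v k ω ∂μ
        + (4 * u ^ 2 + u ^ 4 * C) * ∫ ω, tailSq ε (D k ω) ∂μ) := by
    rw [htel]
    exact norm_sum_le_of_le _ fun k hk => hstep k (Finset.mem_range.1 hk)
  refine this.trans ?_
  rw [← Finset.mul_sum, Finset.sum_add_distrib, ← Finset.mul_sum, ← Finset.mul_sum]
  gcongr

/-- Bounded convergence in probability implies convergence in `L¹`. The functions need not be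
measurable. -/
lemma tendsto_lintegral_zero_of_le_const [IsFiniteMeasure μ] {g : ℕ → Ω → ℝ≥0∞} {M : ℝ≥0∞}
    (hM : M ≠ ∞)
    (hgM : ∀ᶠ n in atTop, ∀ᵐ ω ∂μ, g n ω ≤ M)
    (hg : ∀ δ : ℝ, 0 < δ → Tendsto (fun n => μ {ω | ENNReal.ofReal δ ≤ g n ω}) atTop (𝓝 0)) :
    Tendsto (fun n => ∫⁻ ω, g n ω ∂μ) atTop (𝓝 0) := by
  have hle : ∀ δ : ℝ, 0 < δ → ∀ᶠ n in atTop, ∫⁻ ω, g n ω ∂μ ≤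
      ENNReal.ofReal δ * μ Set.univ + M * μ {ω | ENNReal.ofReal δ ≤ g n ω} := fun δ hδ => by
    filter_upwards [hgM] with n hn
    calc ∫⁻ ω, g n ω ∂μ ≤ ∫⁻ ω, (ENNReal.ofReal δ +
          {ω | ENNReal.ofReal δ ≤ g n ω}.indicator (fun _ => M) ω) ∂μ := by
          refine lintegral_mono_ae ?_
          filter_upwards [hn] with ω hω
          by_cases hc : ENNReal.ofReal δ ≤ g n ω
          · rw [Set.indicator_of_mem (by exact hc)]
            exact hω.trans le_add_self
          · exact (not_le.1 hc).le.trans le_self_add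
      _ = ENNReal.ofReal δ * μ Set.univ +
          ∫⁻ ω, {ω | ENNReal.ofReal δ ≤ g n ω}.indicator (fun _ => M) ω ∂μ := by
          rw [lintegral_add_left measurable_const, lintegral_const]
      _ ≤ _ := by gcongr; exact lintegral_indicator_const_le _ _
  rw [ENNReal.tendsto_nhds_zero]
  intro η hη
  have h1 : Tendsto (fun δ : ℝ => ENNReal.ofReal δ * μ Set.univ) (𝓝[>] 0) (𝓝 0) := by
    have : Tendsto (fun δ : ℝ => ENNReal.ofReal δ * μ Set.univ) (𝓝 0)
        (𝓝 (ENNReal.ofReal 0 * μ Set.univ)) :=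
      ENNReal.Tendsto.mul_const (ENNReal.continuous_ofReal.tendsto 0)
        (Or.inr (measure_ne_top _ _))
    simpa using this.mono_left nhdsWithin_le_nhds
  have hη2 : (0 : ℝ≥0∞) < η / 2 := ENNReal.half_pos hη.ne'
  obtain ⟨δ, hδ, hδ0⟩ := ((ENNReal.tendsto_nhds_zero.1 h1 _ hη2).and self_mem_nhdsWithin).exists
  have h2 : Tendsto (fun n => M * μ {ω | ENNReal.ofReal δ ≤ g n ω}) atTop (𝓝 0) := by
    simpa using ENNReal.Tendsto.const_mul (hg δ hδ0) (Or.inr hM)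
  filter_upwards [hle δ hδ0, ENNReal.tendsto_nhds_zero.1 h2 _ hη2] with n hn1 hn2
  calc ∫⁻ ω, g n ω ∂μ ≤ η / 2 + η / 2 := hn1.trans (add_le_add hδ hn2)
    _ = η := ENNReal.add_halves η

/-- The **martingale central limit theorem** for a triangular array whose conditional variances
have uniformly bounded row sums, converging in probability to `s`, under the Lindeberg condition. -/
theorem tendstoInDistribution_sum_of_isMartingaleDiff [IsProbabilityMeasure μ]
    {ℱ : ℕ → ℕ → MeasurableSpace Ω} {D v : ℕ → ℕ → Ω → ℝ} {C s : ℝ}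
    (h : ∀ n, IsMartingaleDiff μ n (ℱ n) (D n) (v n) C)
    (hs : 0 ≤ s)
    (hv : TendstoInMeasure μ (fun n ω => ∑ t ∈ Finset.range n, v n t ω) atTop fun _ => s)
    (hL : ∀ ε : ℝ, 0 < ε → Tendsto
      (fun n => ∑ t ∈ Finset.range n, ∫ ω, tailSq ε (D n t ω) ∂μ) atTop (𝓝 0)) :
    TendstoInDistribution (fun n ω => ∑ t ∈ Finset.range n, D n t ω) atTop id (fun _ => μ)
      (gaussianReal 0 s.toNNReal) := by
  have hSm : ∀ n, Measurable fun ω => ∑ t ∈ Finset.range n, D n t ω := fun n =>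
    ((h n).measurable_sum le_rfl).mono ((h n).le n le_rfl) le_rfl
  have hvm : ∀ n, Measurable fun ω => ∑ t ∈ Finset.range n, v n t ω := fun n =>
    Finset.measurable_sum _ fun t ht =>
      ((h n).predictable t (Finset.mem_range.1 ht)).mono
        ((h n).le t (Finset.mem_range.1 ht).le) le_rfl
  refine ⟨fun n => (hSm n).aemeasurable, aemeasurable_id, ?_⟩
  refine ProbabilityMeasure.tendsto_iff_tendsto_charFun.2 fun u => ?_
  simp only [ProbabilityMeasure.coe_mk, Measure.map_id, charFun_gaussianReal]
  have hcf : ∀ n, charFun (μ.map fun ω => ∑ t ∈ Finset.range n, D n t ω) u =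
      ∫ ω, Complex.exp ((u * ∑ t ∈ Finset.range n, D n t ω : ℝ) * Complex.I) ∂μ := fun n => by
    rw [charFun_apply_real, integral_map (hSm n).aemeasurable (by fun_prop)]
    simp
  simp_rw [hcf]
  set φ : ℝ → ℝ := fun x => Real.exp (u ^ 2 * x / 2) with hφ
  set K := φ C
  -- the normalized characteristic functions converge to `1`
  have hlim1 : Tendsto (fun n => ∫ ω, Complex.exp ((u * ∑ t ∈ Finset.range n, D n t ω : ℝ)
      * Complex.I) * (φ (∑ t ∈ Finset.range n, v n t ω) : ℝ) ∂μ) atTop (𝓝 1) := by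
    rw [tendsto_iff_norm_sub_tendsto_zero]
    refine tendsto_order.2 ⟨fun a ha => Eventually.of_forall fun n =>
      ha.trans_le (norm_nonneg _), fun η hη => ?_⟩
    have hεlim : Tendsto (fun ε : ℝ => K * ((|u| ^ 3 * ε + u ^ 4 * ε ^ 2) * C)) (𝓝[>] 0)
        (𝓝 0) := by
      have hc : Continuous fun ε : ℝ => K * ((|u| ^ 3 * ε + u ^ 4 * ε ^ 2) * C) := by fun_prop
      simpa using (hc.tendsto 0).mono_left nhdsWithin_le_nhds
    have hεlim2 : Tendsto (fun ε : ℝ => |u| * ε) (𝓝[>] 0) (𝓝 0) := by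
      have hc : Continuous fun ε : ℝ => |u| * ε := by fun_prop
      simpa using (hc.tendsto 0).mono_left nhdsWithin_le_nhds
    obtain ⟨ε, ⟨hε1, hε2⟩, hε0⟩ := (((hεlim.eventually_lt_const hη).and
      (hεlim2.eventually_lt_const one_pos)).and self_mem_nhdsWithin).exists
    have hn := (((hL ε hε0).const_mul (4 * u ^ 2 + u ^ 4 * C)).const_add
      ((|u| ^ 3 * ε + u ^ 4 * ε ^ 2) * C)).const_mul K
    rw [mul_zero, add_zero] at hn
    filter_upwards [hn.eventually_lt_const hε1] with n hn
    exact ((h n).norm_integral_exp_sub_one_le (le_of_lt hε0) hε2.le).trans_lt hn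
  -- the normalization may be replaced by its deterministic limit
  have hlim2 : Tendsto (fun n => ∫ ω, Complex.exp ((u * ∑ t ∈ Finset.range n, D n t ω : ℝ)
      * Complex.I) * ((φ (∑ t ∈ Finset.range n, v n t ω) - φ s : ℝ) : ℂ) ∂μ) atTop (𝓝 0) := by
    rw [tendsto_zero_iff_enorm_tendsto_zero]
    refine tendsto_of_tendsto_of_tendsto_of_le_of_le tendsto_const_nhds
      (h := fun n => ∫⁻ ω, ‖φ (∑ t ∈ Finset.range n, v n t ω) - φ s‖ₑ ∂μ) ?_
      (fun _ => zero_le) fun n => ?_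
    · refine tendsto_lintegral_zero_of_le_const (M := ENNReal.ofReal (K + φ s))
        ENNReal.ofReal_ne_top (Eventually.of_forall fun n => ae_of_all _ fun ω => ?_)
        fun δ hδ => ?_
      · rw [Real.enorm_eq_ofReal_abs]
        refine ENNReal.ofReal_le_ofReal ((abs_sub _ _).trans ?_)
        rw [abs_of_pos (Real.exp_pos _), abs_of_pos (Real.exp_pos _)]
        gcongr
        have := (h n).sum_le ω
        exact Real.exp_le_exp.2 (by gcongr)
      · have hc : ContinuousAt φ s := by fun_prop
        obtain ⟨η, hη, hηδ⟩ := Metric.continuousAt_iff.1 hc δ hδ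
        refine tendsto_of_tendsto_of_tendsto_of_le_of_le tendsto_const_nhds
          (tendstoInMeasure_iff_dist.1 hv η hη) (fun _ => zero_le)
          fun n => measure_mono fun ω hω => ?_
        by_contra hcon
        have h1 := hηδ (not_le.1 hcon)
        rw [Set.mem_ofPred_eq, Real.enorm_eq_ofReal_abs,
          ENNReal.ofReal_le_ofReal_iff (abs_nonneg _)] at hω
        exact absurd hω (not_le.2 h1)
    · refine (enorm_integral_le_lintegral_enorm _).trans (le_of_eq ?_)
      refine lintegral_congr fun ω => ?_
      rw [enorm_mul, ← ofReal_norm (Complex.exp _), Complex.norm_exp_ofReal_mul_I,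
        ENNReal.ofReal_one, one_mul, ← ofReal_norm, Complex.norm_real, ofReal_norm]
  have hφs : (φ s : ℂ) ≠ 0 := by exact_mod_cast (Real.exp_pos _).ne'
  have hlim := ((hlim1.sub hlim2).div_const (φ s : ℂ))
  have hgoal : (1 - 0) / (φ s : ℂ) =
      Complex.exp (u * (0 : ℝ) * Complex.I - (s.toNNReal : ℝ) * u ^ 2 / 2) := by
    rw [Real.coe_toNNReal _ hs, hφ, sub_zero, one_div]
    push_cast
    rw [← Complex.exp_neg]
    congr 1
    ring
  rw [hgoal] at hlim
  refine hlim.congr fun n => ?_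
  have hm1 : ∀ x : ℝ → ℝ, Measurable x → AEStronglyMeasurable (fun ω =>
      Complex.exp ((u * ∑ t ∈ Finset.range n, D n t ω : ℝ) * Complex.I) *
        (x (∑ t ∈ Finset.range n, v n t ω) : ℝ)) μ := fun x hx => by
    have h1 := hSm n
    have h2 := hx.comp (hvm n)
    refine Measurable.aestronglyMeasurable ?_
    refine Measurable.mul (by fun_prop) (Complex.measurable_ofReal.comp h2)
  have hφm : Measurable φ := by fun_prop
  have hb : ∀ ω, φ (∑ t ∈ Finset.range n, v n t ω) ≤ K := fun ω => by
    have := (h n).sum_le ω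
    exact Real.exp_le_exp.2 (by gcongr)
  rw [← integral_sub, div_eq_iff hφs, ← integral_mul_const]
  · refine integral_congr_ae (ae_of_all _ fun ω => ?_)
    push_cast
    ring
  · refine .of_bound (hm1 φ hφm) K (ae_of_all _ fun ω => ?_)
    rw [norm_mul, Complex.norm_exp_ofReal_mul_I, one_mul, Complex.norm_real,
      Real.norm_of_nonneg (Real.exp_pos _).le]
    exact hb ω
  · refine .of_bound (hm1 (fun x => φ x - φ s) (by fun_prop)) (K + φ s) (ae_of_all _ fun ω => ?_)
    rw [norm_mul, Complex.norm_exp_ofReal_mul_I, one_mul, Complex.norm_real]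
    refine (norm_sub_le _ _).trans ?_
    rw [Real.norm_of_nonneg (Real.exp_pos _).le, Real.norm_of_nonneg (Real.exp_pos _).le]
    gcongr
    exact hb ω

end Martingale

/-! ### Joint law of past, point and decision -/

section Disintegration

variable {Ω Ω' 𝒵 : Type*} [MeasurableSpace Ω] [MeasurableSpace Ω'] [MeasurableSpace 𝒵]
  {μ : Measure Ω} [IsProbabilityMeasure μ]

/-- A conditional expectation given `a`, written as a function of `a`, may be substituted under
an integral against functions of `a`. -/
lemma lintegral_ofReal_mul_of_condExp {a : Ω → Ω'} (ha : Measurable a) {g : Ω → ℝ} {r : Ω' → ℝ}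
    (hg : Integrable g μ) (hg0 : ∀ ω, 0 ≤ g ω) (hr : Measurable r) (hr0 : ∀ x, 0 ≤ r x)
    (hgr : μ[g|MeasurableSpace.comap a inferInstance] =ᵐ[μ] fun ω => r (a ω))
    {k : Ω' → ℝ≥0∞} (hk : Measurable k) :
    ∫⁻ ω, ENNReal.ofReal (g ω) * k (a ω) ∂μ
      = ∫⁻ ω, ENNReal.ofReal (r (a ω)) * k (a ω) ∂μ := by
  have hri : Integrable (fun ω => r (a ω)) μ := integrable_condExp.congr hgr
  have hmap : (μ.withDensity fun ω => ENNReal.ofReal (g ω)).map a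
      = (μ.withDensity fun ω => ENNReal.ofReal (r (a ω))).map a := by
    ext A hA
    rw [Measure.map_apply ha hA, Measure.map_apply ha hA, withDensity_apply _ (ha hA),
      withDensity_apply _ (ha hA), ← ofReal_integral_eq_lintegral_ofReal hg.integrableOn
        (ae_of_all _ hg0), ← ofReal_integral_eq_lintegral_ofReal hri.integrableOn
        (ae_of_all _ fun ω => hr0 _), ← setIntegral_condExp ha.comap_le hg ⟨A, hA, rfl⟩]
    congr 1
    exact setIntegral_congr_ae (ha hA) (hgr.mono fun ω h _ => h)
  have h1 : ∫⁻ ω, k (a ω) ∂(μ.withDensity fun ω => ENNReal.ofReal (g ω))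
      = ∫⁻ ω, k (a ω) ∂(μ.withDensity fun ω => ENNReal.ofReal (r (a ω))) := by
    rw [← lintegral_map hk ha, hmap, lintegral_map hk ha]
  have hka : Measurable fun ω => k (a ω) := hk.comp ha
  have hra : Measurable fun ω => ENNReal.ofReal (r (a ω)) := (hr.comp ha).ennreal_ofReal
  rwa [lintegral_withDensity_eq_lintegral_mul₀ hg.aemeasurable.ennreal_ofReal hka.aemeasurable,
    lintegral_withDensity_eq_lintegral_mul _ hra hka] at h1

/-- If the fresh point `Z ∼ P` is independent of the past `p` and the decision `ξ` is Bernoulli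
with parameter `q (p, Z)` given past and point, then the joint law of `(p, Z, ξ)` is obtained by
drawing the past, the point and an independent uniform variable `u`, with decision
`1{u ≤ q (p, Z)}`. -/
lemma map_past_point_decision {P : Measure 𝒵} [IsProbabilityMeasure P]
    {p : Ω → Ω'} {Z : Ω → 𝒵} {ξ : Ω → ℝ} {q : Ω' × 𝒵 → I}
    (hp : Measurable p) (hZ : Measurable Z) (hξ : Measurable ξ) (hq : Measurable q)
    (hlaw : μ.map Z = P) (hind : IndepFun p Z μ) (h01 : ∀ ω, ξ ω = 0 ∨ ξ ω = 1)
    (hb : μ[ξ|MeasurableSpace.comap (fun ω => (p ω, Z ω)) inferInstance]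
      =ᵐ[μ] fun ω => (q (p ω, Z ω) : ℝ)) :
    μ.map (fun ω => (p ω, (Z ω, ξ ω)))
      = ((μ.map p).prod (P.prod (volume : Measure I))).map fun a =>
        (a.1, (a.2.1, {u : I | u ≤ q (a.1, a.2.1)}.indicator (fun _ => (1 : ℝ)) a.2.2)) := by
  have hpZ : Measurable fun ω => (p ω, Z ω) := hp.prodMk hZ
  have : IsProbabilityMeasure (μ.map p) := Measure.isProbabilityMeasure_map hp.aemeasurable
  have hΦ : Measurable fun a : Ω' × 𝒵 × I =>
      (a.1, (a.2.1, {u : I | u ≤ q (a.1, a.2.1)}.indicator (fun _ => (1 : ℝ)) a.2.2)) := by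
    refine measurable_fst.prodMk (measurable_snd.fst.prodMk ?_)
    have : MeasurableSet {a : Ω' × 𝒵 × I | a.2.2 ≤ q (a.1, a.2.1)} :=
      measurableSet_le (by fun_prop) (by fun_prop)
    exact (measurable_const (a := (1 : ℝ))).indicator this
  have hξi : Integrable ξ μ := .of_bound hξ.aestronglyMeasurable 1 (ae_of_all _ fun ω => by
    rcases h01 ω with h | h <;> simp [h])
  have hmeas : Measurable fun ω => (p ω, (Z ω, ξ ω)) := hp.prodMk (hZ.prodMk hξ)
  refine Measure.ext_of_lintegral _ fun h hh => ?_
  rw [lintegral_map hh hmeas, lintegral_map hh hΦ]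
  have hk1 : Measurable fun x : Ω' × 𝒵 => h (x.1, (x.2, (1 : ℝ))) := by fun_prop
  have hk0 : Measurable fun x : Ω' × 𝒵 => h (x.1, (x.2, (0 : ℝ))) := by fun_prop
  have hb' : μ[fun ω => 1 - ξ ω|MeasurableSpace.comap (fun ω => (p ω, Z ω)) inferInstance]
      =ᵐ[μ] fun ω => 1 - (q (p ω, Z ω) : ℝ) := by
    have h1 := condExp_sub (integrable_const (1 : ℝ)) hξi
      (MeasurableSpace.comap (fun ω => (p ω, Z ω)) inferInstance)
    rw [condExp_const hpZ.comap_le] at h1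
    refine h1.trans ?_
    filter_upwards [hb] with ω hω
    simp [hω]
  have e1 := lintegral_ofReal_mul_of_condExp hpZ hξi
    (fun ω => by rcases h01 ω with h | h <;> simp [h])
    (r := fun x => (q x : ℝ)) (by fun_prop) (fun x => (q x).2.1) hb hk1
  have e0 := lintegral_ofReal_mul_of_condExp hpZ ((integrable_const (1 : ℝ)).sub hξi)
    (fun ω => by rcases h01 ω with h | h <;> simp [h])
    (r := fun x => 1 - (q x : ℝ)) (by fun_prop) (fun x => sub_nonneg.2 (q x).2.2) hb' hk0
  have hprod : μ.map (fun ω => (p ω, Z ω)) = (μ.map p).prod P := by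
    rw [(indepFun_iff_map_prod_eq_prod_map_map hp.aemeasurable hZ.aemeasurable).1 hind, hlaw]
  calc ∫⁻ ω, h (p ω, (Z ω, ξ ω)) ∂μ
      = ∫⁻ ω, (ENNReal.ofReal (ξ ω) * h (p ω, (Z ω, (1 : ℝ)))
          + ENNReal.ofReal (1 - ξ ω) * h (p ω, (Z ω, (0 : ℝ)))) ∂μ := by
        refine lintegral_congr fun ω => ?_
        rcases h01 ω with h | h <;> simp [h]
    _ = ∫⁻ ω, (ENNReal.ofReal (q (p ω, Z ω)) * h (p ω, (Z ω, (1 : ℝ)))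
          + ENNReal.ofReal (1 - q (p ω, Z ω)) * h (p ω, (Z ω, (0 : ℝ)))) ∂μ := by
        rw [lintegral_add_left (by fun_prop), lintegral_add_left (by fun_prop)]
        exact congrArg₂ _ e1 e0
    _ = ∫⁻ x, (ENNReal.ofReal (q x) * h (x.1, (x.2, (1 : ℝ)))
          + ENNReal.ofReal (1 - q x) * h (x.1, (x.2, (0 : ℝ)))) ∂((μ.map p).prod P) := by
        rw [← hprod, lintegral_map (by fun_prop) hpZ]
    _ = ∫⁻ x, ∫⁻ z, (ENNReal.ofReal (q (x, z)) * h (x, (z, (1 : ℝ)))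
          + ENNReal.ofReal (1 - q (x, z)) * h (x, (z, (0 : ℝ)))) ∂P ∂(μ.map p) := by
        rw [lintegral_prod _ (Measurable.aemeasurable (by fun_prop))]
    _ = _ := by
        have hhΦ : Measurable fun a : Ω' × 𝒵 × I => h (a.1, (a.2.1,
            {u : I | u ≤ q (a.1, a.2.1)}.indicator (fun _ => (1 : ℝ)) a.2.2)) := hh.comp hΦ
        rw [lintegral_prod _ (Measurable.aemeasurable hhΦ)]
        refine lintegral_congr fun x => ?_
        have hhΦx : Measurable fun y : 𝒵 × I => h (x, (y.1,
            {u : I | u ≤ q (x, y.1)}.indicator (fun _ => (1 : ℝ)) y.2)) :=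
          hhΦ.comp measurable_prodMk_left
        rw [lintegral_prod _ hhΦx.aemeasurable]
        refine lintegral_congr fun z => ?_
        have hs : MeasurableSet {u : I | u ≤ q (x, z)} := measurableSet_Iic
        have hv : volume {u : I | u ≤ q (x, z)} = ENNReal.ofReal (q (x, z)) :=
          unitInterval.volume_Iic _
        have hvc : volume {u : I | u ≤ q (x, z)}ᶜ = ENNReal.ofReal (1 - q (x, z)) := by
          rw [prob_compl_eq_one_sub hs, hv, ENNReal.ofReal_sub _ (q (x, z)).2.1,
            ENNReal.ofReal_one]
        rw [← lintegral_add_compl _ hs]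
        have i1 : ∫⁻ u in {u : I | u ≤ q (x, z)}, h (x, (z,
            {u : I | u ≤ q (x, z)}.indicator (fun _ => (1 : ℝ)) u))
            = ENNReal.ofReal (q (x, z)) * h (x, (z, (1 : ℝ))) := by
          rw [setLIntegral_congr_fun hs (g := fun _ => h (x, (z, (1 : ℝ)))) fun u hu => by
            simp only [Set.indicator_of_mem hu], setLIntegral_const, hv, mul_comm]
        have i0 : ∫⁻ u in {u : I | u ≤ q (x, z)}ᶜ, h (x, (z,
            {u : I | u ≤ q (x, z)}.indicator (fun _ => (1 : ℝ)) u))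
            = ENNReal.ofReal (1 - q (x, z)) * h (x, (z, (0 : ℝ))) := by
          rw [setLIntegral_congr_fun hs.compl (g := fun _ => h (x, (z, (0 : ℝ)))) fun u hu => by
            simp only [Set.indicator_of_notMem hu], setLIntegral_const, hvc, mul_comm]
        exact (congrArg₂ _ i1 i0).symm

end Disintegration

/-! ### Conditional laws driven by independent randomness -/

section ConditionalLaw

variable {Ω Ω' S : Type*} {mΩ : MeasurableSpace Ω} {mΩ' : MeasurableSpace Ω'}
  {mS : MeasurableSpace S} {μ : Measure Ω} {ν : Measure S}

/-- Given the past `p`, the variable `Z` is distributed as `G (p, s)` with an independent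
`s ∼ ν`. -/
structure HasCondLaw {Ω Ω' S : Type*} [MeasurableSpace Ω] [MeasurableSpace Ω']
    [MeasurableSpace S] (μ : Measure Ω) (ν : Measure S) (p : Ω → Ω') (Z : Ω → ℝ)
    (G : Ω' × S → ℝ) : Prop where
  measurable_past : Measurable p
  measurable_var : Measurable Z
  measurable_fun : Measurable G
  map_eq : μ.map (fun ω => (p ω, Z ω)) = ((μ.map p).prod ν).map fun a => (a.1, G a)

variable [IsProbabilityMeasure ν] {p : Ω → Ω'} {Z : Ω → ℝ}
  {G : Ω' × S → ℝ}

lemma HasCondLaw.lintegral_eq (hl : HasCondLaw μ ν p Z G) {h : Ω' × ℝ → ℝ≥0∞}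
    (hh : Measurable h) :
    ∫⁻ ω, h (p ω, Z ω) ∂μ = ∫⁻ ω, ∫⁻ s, h (p ω, G (p ω, s)) ∂ν ∂μ := by
  have hp := hl.measurable_past
  have hG := hl.measurable_fun
  have hm : Measurable fun a : Ω' × S => h (a.1, G a) := by fun_prop
  rw [← lintegral_map (f := h) (g := fun ω => (p ω, Z ω)) hh (hp.prodMk hl.measurable_var),
    hl.map_eq, lintegral_map hh (by fun_prop), lintegral_prod _ hm.aemeasurable,
    lintegral_map hm.lintegral_prod_right' hp]

lemma HasCondLaw.condLExp_ae_eq [IsProbabilityMeasure μ] (hl : HasCondLaw μ ν p Z G)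
    {h : Ω' × ℝ → ℝ≥0∞}
    (hh : Measurable h) :
    condLExp (MeasurableSpace.comap p mΩ') μ (fun ω => h (p ω, Z ω))
      =ᵐ[μ] fun ω => ∫⁻ s, h (p ω, G (p ω, s)) ∂ν := by
  have hp := hl.measurable_past
  have hG := hl.measurable_fun
  have hm : Measurable fun a : Ω' × S => h (a.1, G a) := by fun_prop
  symm
  refine ae_eq_condLExp hp.comap_le μ _
    (hm.lintegral_prod_right'.comp (comap_measurable p)) ?_
  rintro _ ⟨A, hA, rfl⟩
  have hAi : Measurable (A.indicator fun _ => (1 : ℝ≥0∞)) := measurable_const.indicator hA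
  have e := hl.lintegral_eq (h := fun x => A.indicator (fun _ => (1 : ℝ≥0∞)) x.1 * h x)
    ((hAi.comp measurable_fst).mul hh)
  rw [← lintegral_indicator (hp hA), ← lintegral_indicator (hp hA)]
  have e1 : ∀ ω, A.indicator (fun _ => (1 : ℝ≥0∞)) (p ω) * h (p ω, Z ω)
      = (p ⁻¹' A).indicator (fun ω => h (p ω, Z ω)) ω := fun ω => by
    by_cases hω : p ω ∈ A
    · rw [Set.indicator_of_mem hω, Set.indicator_of_mem (by exact hω), one_mul]
    · rw [Set.indicator_of_notMem hω, Set.indicator_of_notMem (by exact hω), zero_mul]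
  have e2 : ∀ ω, ∫⁻ s, A.indicator (fun _ => (1 : ℝ≥0∞)) (p ω) * h (p ω, G (p ω, s)) ∂ν
      = (p ⁻¹' A).indicator (fun ω => ∫⁻ s, h (p ω, G (p ω, s)) ∂ν) ω := fun ω => by
    by_cases hω : p ω ∈ A
    · simp only [Set.indicator_of_mem hω, one_mul]
      rw [Set.indicator_of_mem (by exact hω)]
    · simp only [Set.indicator_of_notMem hω, zero_mul, lintegral_zero]
      rw [Set.indicator_of_notMem (by exact hω)]
  simp only [e1, e2] at e
  exact e.symm

lemma HasCondLaw.condExp_ae_eq [IsProbabilityMeasure μ] (hl : HasCondLaw μ ν p Z G) {h : Ω' × ℝ → ℝ}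
    (hh : Measurable h) (hi : Integrable (fun ω => h (p ω, Z ω)) μ) :
    μ[fun ω => h (p ω, Z ω)|MeasurableSpace.comap p mΩ']
      =ᵐ[μ] fun ω => ∫ s, h (p ω, G (p ω, s)) ∂ν := by
  have hp := hl.measurable_past
  have hG := hl.measurable_fun
  have hZ := hl.measurable_var
  have : IsProbabilityMeasure (μ.map p) := Measure.isProbabilityMeasure_map hp.aemeasurable
  have hm : Measurable fun a : Ω' × S => h (a.1, G a) := by fun_prop
  have hpZ : Measurable fun ω => (p ω, Z ω) := hp.prodMk hZ
  have hpG : Measurable fun a : Ω' × S => (a.1, G a) := by fun_prop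
  have hi' : Integrable (fun a : Ω' × S => h (a.1, G a)) ((μ.map p).prod ν) := by
    have := (integrable_map_measure hh.aestronglyMeasurable hpZ.aemeasurable).2 hi
    rw [hl.map_eq] at this
    exact (integrable_map_measure hh.aestronglyMeasurable hpG.aemeasurable).1 this
  have hsm : StronglyMeasurable fun a => ∫ s, h (a, G (a, s)) ∂ν :=
    hm.stronglyMeasurable.integral_prod_right'
  symm
  refine ae_eq_condExp_of_forall_setIntegral_eq hp.comap_le hi (fun s _ _ => ?_) ?_
    (hsm.comp_measurable (comap_measurable p)).aestronglyMeasurable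
  · exact ((integrable_map_measure hsm.aestronglyMeasurable hp.aemeasurable).1
      hi'.integral_prod_left).integrableOn
  · rintro _ ⟨A, hA, rfl⟩ -
    calc ∫ ω in p ⁻¹' A, ∫ s, h (p ω, G (p ω, s)) ∂ν ∂μ
        = ∫ a in A, ∫ s, h (a, G (a, s)) ∂ν ∂(μ.map p) :=
          (setIntegral_map hA hsm.aestronglyMeasurable hp.aemeasurable).symm
      _ = ∫ a in A ×ˢ Set.univ, h (a.1, G a) ∂((μ.map p).prod ν) := by
          rw [setIntegral_prod _ hi'.integrableOn, Measure.restrict_univ]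
      _ = ∫ x in A ×ˢ Set.univ, h x ∂(((μ.map p).prod ν).map fun a => (a.1, G a)) := by
          rw [setIntegral_map (hA.prod .univ) hh.aestronglyMeasurable hpG.aemeasurable]
          congr 2
      _ = ∫ ω in p ⁻¹' A, h (p ω, Z ω) ∂μ := by
          rw [← hl.map_eq, setIntegral_map (hA.prod .univ) hh.aestronglyMeasurable
            hpZ.aemeasurable]
          congr 2
          ext a; simp

/-- A multiple `c (p) (Z - θ)` of a conditionally centred variable is a square integrable
martingale difference if `c` tames the conditional second moment, even though `Z` itself need not be
integrable. -/
lemma HasCondLaw.martingaleDiff [IsProbabilityMeasure μ] (hl : HasCondLaw μ ν p Z G) {θ : ℝ}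
    (hmean : ∀ᵐ ω ∂μ, Integrable (fun s => G (p ω, s)) ν ∧ ∫ s, G (p ω, s) ∂ν = θ)
    {c : Ω' → ℝ} (hc : Measurable c) {M : ℝ≥0∞} (hM : M ≠ ∞)
    (hcM : ∀ a, ENNReal.ofReal (c a ^ 2) * ∫⁻ s, ENNReal.ofReal ((G (a, s) - θ) ^ 2) ∂ν ≤ M) :
    MemLp (fun ω => c (p ω) * (Z ω - θ)) 2 μ ∧
    μ[fun ω => c (p ω) * (Z ω - θ)|MeasurableSpace.comap p mΩ'] =ᵐ[μ] 0 ∧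
    μ[fun ω => (c (p ω) * (Z ω - θ)) ^ 2|MeasurableSpace.comap p mΩ'] =ᵐ[μ] fun ω =>
      (ENNReal.ofReal (c (p ω) ^ 2) *
        ∫⁻ s, ENNReal.ofReal ((G (p ω, s) - θ) ^ 2) ∂ν).toReal := by
  have hp := hl.measurable_past
  have hG := hl.measurable_fun
  have hZ := hl.measurable_var
  have hDm : Measurable fun ω => c (p ω) * (Z ω - θ) :=
    (hc.comp hp).mul (hZ.sub_const θ)
  have hin : ∀ a, ∫⁻ s, ENNReal.ofReal ((c a * (G (a, s) - θ)) ^ 2) ∂ν =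
      ENNReal.ofReal (c a ^ 2) * ∫⁻ s, ENNReal.ofReal ((G (a, s) - θ) ^ 2) ∂ν := fun a => by
    rw [← lintegral_const_mul _ (by fun_prop)]
    refine lintegral_congr fun s => ?_
    rw [mul_pow, ENNReal.ofReal_mul (sq_nonneg _)]
  have hsq : Measurable fun x : Ω' × ℝ => (c x.1 * (x.2 - θ)) ^ 2 := by fun_prop
  have hfin : ∫⁻ ω, ENNReal.ofReal ((c (p ω) * (Z ω - θ)) ^ 2) ∂μ ≤ M := by
    rw [hl.lintegral_eq (h := fun x => ENNReal.ofReal ((c x.1 * (x.2 - θ)) ^ 2))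
      hsq.ennreal_ofReal]
    simp only [hin]
    calc _ ≤ ∫⁻ _, M ∂μ := lintegral_mono fun ω => hcM _
      _ = M := by simp
  have hL2 : MemLp (fun ω => c (p ω) * (Z ω - θ)) 2 μ := by
    refine (memLp_two_iff_integrable_sq hDm.aestronglyMeasurable).2
      ⟨(hDm.pow_const 2).aestronglyMeasurable, ?_⟩
    rw [hasFiniteIntegral_iff_ofReal (ae_of_all _ fun ω => sq_nonneg _)]
    exact hfin.trans_lt hM.lt_top
  refine ⟨hL2, ?_, ?_⟩
  · refine (hl.condExp_ae_eq (h := fun x => c x.1 * (x.2 - θ)) (by fun_prop)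
      (hL2.integrable (by norm_num))).trans ?_
    filter_upwards [hmean] with ω hω
    rw [integral_const_mul, integral_sub hω.1 (integrable_const _), hω.2]
    simp
  · refine (hl.condExp_ae_eq (h := fun x => (c x.1 * (x.2 - θ)) ^ 2) hsq
      hL2.integrable_sq).trans (ae_of_all _ fun ω => ?_)
    simp only
    rw [integral_eq_lintegral_of_nonneg_ae (ae_of_all _ fun s => sq_nonneg _)
      (Measurable.aestronglyMeasurable (by fun_prop)), hin]

end ConditionalLaw

/-! ### Increments of a sequential scheme -/

section Pair

variable {𝒳 : Type*} [MeasurableSpace 𝒳] {P : Measure (𝒳 × ℝ)} [IsProbabilityMeasure P]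
  {f : 𝒳 → ℝ} {π : 𝒳 → I}

/-- Inverse probability weighting makes the increment unbiased. Where `π = 0` the weight is
`0 / 0 = 0`, and there the model is correct. -/
lemma IsModelRulePair.integral_genericIncrement (h : IsModelRulePair P f π) :
    ∫ s, genericIncrement f π s ∂(P.prod (volume : Measure I)) = ∫ p, p.2 ∂P := by
  rw [integral_prod _ (h.finite_variance.integrable (by norm_num))]
  refine integral_congr_ae ?_
  filter_upwards [h.pos_or_correct] with z hz
  have hs : MeasurableSet {u : I | u ≤ π z.1} := measurableSet_Iic
  have hv : (volume : Measure I).real {u : I | u ≤ π z.1} = π z.1 := by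
    rw [measureReal_def, show {u : I | u ≤ π z.1} = Set.Iic (π z.1) from rfl,
      unitInterval.volume_Iic, ENNReal.toReal_ofReal (π z.1).2.1]
  have hi : Integrable ({u : I | u ≤ π z.1}.indicator fun _ => (1 : ℝ)) volume :=
    (integrable_const _).indicator hs
  have : ∫ u, genericIncrement f π (z, u) ∂(volume : Measure I) =
      f z.1 + (z.2 - f z.1) * ((π z.1 : ℝ) / (π z.1 : ℝ)) := by
    simp only [genericIncrement, increment]
    rw [integral_add (integrable_const _) ((hi.div_const _).const_mul _), integral_const_mul,
      integral_div, integral_indicator_const _ hs, hv]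
    simp
  rw [this]
  rcases hz with hz | hz
  · have : (π z.1 : ℝ) ≠ 0 := by
      have h0 : (0 : ℝ) < π z.1 := by exact_mod_cast hz
      exact h0.ne'
    rw [div_self this]; ring
  · rw [hz]; ring

lemma IsModelRulePair.lintegral_sq_eq (h : IsModelRulePair P f π) :
    ∫⁻ s, ENNReal.ofReal ((genericIncrement f π s - ∫ p, p.2 ∂P) ^ 2)
      ∂(P.prod (volume : Measure I)) = ENNReal.ofReal (V P f π) := by
  rw [V, h.finite_variance.ofReal_variance_eq, evariance]
  refine lintegral_congr fun s => ?_
  rw [h.integral_genericIncrement, Real.enorm_eq_ofReal_abs,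
    ← ENNReal.ofReal_pow (abs_nonneg _), sq_abs]

end Pair

section Scheme

variable {Ω 𝒳 : Type*} {mΩ : MeasurableSpace Ω} [MeasurableSpace 𝒳] {μ : Measure Ω}

/-- The increment inherits its conditional law given the past from the joint law of past, point and
decision, of which it is a function. -/
lemma hasCondLaw_increment {Ω' : Type*} [MeasurableSpace Ω'] [IsProbabilityMeasure μ]
    {P : Measure (𝒳 × ℝ)} [IsProbabilityMeasure P]
    {p : Ω → Ω'} {X : Ω → 𝒳} {Y ξ : Ω → ℝ} {f : Ω' → 𝒳 → ℝ} {π : Ω' → 𝒳 → I}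
    (hp : Measurable p) (hX : Measurable X) (hY : Measurable Y) (hξ : Measurable ξ)
    (hf : Measurable fun a : Ω' × 𝒳 => f a.1 a.2) (hπ : Measurable fun a : Ω' × 𝒳 => π a.1 a.2)
    (hlaw : μ.map (fun ω => (X ω, Y ω)) = P)
    (hind : IndepFun p (fun ω => (X ω, Y ω)) μ) (h01 : ∀ ω, ξ ω = 0 ∨ ξ ω = 1)
    (hb : μ[ξ|MeasurableSpace.comap (fun ω => (p ω, (X ω, Y ω))) inferInstance]
      =ᵐ[μ] fun ω => (π (p ω) (X ω) : ℝ)) :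
    HasCondLaw μ (P.prod (volume : Measure I)) p
      (fun ω => increment (f (p ω)) (π (p ω)) (X ω) (Y ω) (ξ ω))
      (fun a => genericIncrement (f a.1) (π a.1) a.2) := by
  have hq : Measurable fun x : Ω' × 𝒳 × ℝ => π x.1 x.2.1 :=
    hπ.comp (measurable_fst.prodMk measurable_snd.fst)
  have hf' : Measurable fun x : Ω' × 𝒳 × ℝ => f x.1 x.2.1 :=
    hf.comp (measurable_fst.prodMk measurable_snd.fst)
  have hinc : Measurable fun x : Ω' × (𝒳 × ℝ) × ℝ =>
      increment (f x.1) (π x.1) x.2.1.1 x.2.1.2 x.2.2 := by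
    have hsub : Measurable fun x : Ω' × (𝒳 × ℝ) × ℝ => (x.1, x.2.1) := by fun_prop
    have h1 : Measurable fun x : Ω' × (𝒳 × ℝ) × ℝ => f x.1 x.2.1.1 := hf'.comp hsub
    have h2 : Measurable fun x : Ω' × (𝒳 × ℝ) × ℝ => π x.1 x.2.1.1 := hq.comp hsub
    unfold increment
    fun_prop
  have hΦ : Measurable fun a : Ω' × (𝒳 × ℝ) × I =>
      (a.1, (a.2.1, {u : I | u ≤ π a.1 a.2.1.1}.indicator (fun _ => (1 : ℝ)) a.2.2)) := by
    refine measurable_fst.prodMk (measurable_snd.fst.prodMk ?_)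
    have h2 : Measurable fun x : Ω' × (𝒳 × ℝ) × I => π x.1 x.2.1.1 :=
      hq.comp (measurable_fst.prodMk measurable_snd.fst)
    have : MeasurableSet {a : Ω' × (𝒳 × ℝ) × I | a.2.2 ≤ π a.1 a.2.1.1} :=
      measurableSet_le (by fun_prop) h2
    exact (measurable_const (a := (1 : ℝ))).indicator this
  have hm : Measurable fun ω => (p ω, ((X ω, Y ω), ξ ω)) :=
    hp.prodMk ((hX.prodMk hY).prodMk hξ)
  refine ⟨hp, hinc.comp hm, hinc.comp hΦ, ?_⟩
  have h := map_past_point_decision (q := fun x : Ω' × 𝒳 × ℝ => π x.1 x.2.1) hp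
    (hX.prodMk hY) hξ hq hlaw hind h01 hb
  have h2 := congrArg (Measure.map fun x : Ω' × (𝒳 × ℝ) × ℝ =>
    (x.1, increment (f x.1) (π x.1) x.2.1.1 x.2.1.2 x.2.2)) h
  rw [Measure.map_map (measurable_fst.prodMk hinc) hm,
    Measure.map_map (measurable_fst.prodMk hinc) hΦ] at h2
  exact h2

variable {X : ℕ → Ω → 𝒳} {Y ξ : ℕ → Ω → ℝ} {f : ℕ → Ω → 𝒳 → ℝ} {π : ℕ → Ω → 𝒳 → I} {n : ℕ}
  {P : Measure (𝒳 × ℝ)}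

lemma history_mono : Monotone (history X Y ξ) := fun _ _ hst =>
  iSup₂_mono' fun r hr => ⟨r, hr.trans_le hst, le_rfl⟩

lemma IsSequentialScheme.history_le (h : IsSequentialScheme μ P n X Y ξ f π) {t : ℕ}
    (ht : t ≤ n) : history X Y ξ t ≤ mΩ := iSup₂_le fun s hs => by
  have hs' := hs.trans_le ht
  exact ((h.measurable_X s hs').prodMk (((h.measurable_Y s hs').mul (h.measurable_ξ s hs')).prodMk
    (h.measurable_ξ s hs'))).comap_le

/-- The increment depends on the label only through the collected part `Y ξ`, so it is known after
the decision. -/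
lemma IsSequentialScheme.measurable_increment (h : IsSequentialScheme μ P n X Y ξ f π) {t : ℕ}
    (ht : t < n) : Measurable[history X Y ξ (t + 1)] (Δ X Y ξ f π t) := by
  have hobs : Measurable[history X Y ξ (t + 1)] fun ω => (X t ω, Y t ω * ξ t ω, ξ t ω) :=
    (comap_measurable _).mono
      (le_iSup₂_of_le (f := fun s (_ : s < t + 1) => MeasurableSpace.comap
        (fun ω => (X s ω, Y s ω * ξ s ω, ξ s ω)) inferInstance) t (Nat.lt_succ_self t) le_rfl)
      le_rfl
  have hpast : Measurable[history X Y ξ (t + 1), (history X Y ξ t).prod inferInstance]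
      fun ω => (ω, X t ω) :=
    Measurable.prodMk
      (measurable_id'.mono (history_mono (Nat.le_succ t)) le_rfl) hobs.fst
  have h1 : Measurable[history X Y ξ (t + 1)] fun ω => f t ω (X t ω) :=
    (h.predictable_model t ht).comp hpast
  have h2 : Measurable[history X Y ξ (t + 1)] fun ω => π t ω (X t ω) :=
    (h.predictable_rule t ht).comp hpast
  have h3 : Measurable[history X Y ξ (t + 1)] fun ω => Y t ω * ξ t ω := hobs.snd.fst
  have h4 : Measurable[history X Y ξ (t + 1)] fun ω => ξ t ω := hobs.snd.snd
  have e : Δ X Y ξ f π t = fun ω => f t ω (X t ω) +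
      (Y t ω * ξ t ω - f t ω (X t ω) * ξ t ω) / (π t ω (X t ω) : ℝ) := by
    ext ω; simp only [Δ, increment]; ring
  rw [e]
  exact h1.add ((h3.sub (h1.mul h4)).div (measurable_subtype_coe.comp h2))

/-- Given the history, the increment is distributed as the generic increment of the current pair. -/
lemma IsSequentialScheme.hasCondLaw [IsProbabilityMeasure μ] [IsProbabilityMeasure P]
    (h : IsSequentialScheme μ P n X Y ξ f π) {t : ℕ} (ht : t < n) :
    @HasCondLaw Ω Ω ((𝒳 × ℝ) × I) mΩ (history X Y ξ t) _ μ (P.prod (volume : Measure I)) id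
      (Δ X Y ξ f π t) fun a => genericIncrement (f t a.1) (π t a.1) a.2 := by
  have hle := h.history_le ht.le
  refine @hasCondLaw_increment Ω 𝒳 mΩ _ μ Ω (history X Y ξ t) _ P _ id (X t) (Y t) (ξ t) (f t) (π t)
    (fun s hs => hle s hs) (h.measurable_X t ht) (h.measurable_Y t ht)
    (h.measurable_ξ t ht) (h.predictable_model t ht) (h.predictable_rule t ht) (h.law t ht) ?_
    (h.decision t ht) ?_
  · refine (IndepFun_iff_Indep (mβ := history X Y ξ t) id (fun ω => (X t ω, Y t ω)) μ).2 ?_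
    rw [MeasurableSpace.comap_id]
    exact (h.fresh t ht).symm
  · have e : @MeasurableSpace.comap Ω (Ω × 𝒳 × ℝ) (fun ω => (id ω, (X t ω, Y t ω)))
        ((history X Y ξ t).prod inferInstance) = history X Y ξ t ⊔
          MeasurableSpace.comap (fun ω => (X t ω, Y t ω)) inferInstance := by
      rw [MeasurableSpace.prod, MeasurableSpace.comap_sup, MeasurableSpace.comap_comp,
        MeasurableSpace.comap_comp]
      congr 1
      exact MeasurableSpace.comap_id
    have hb := h.bernoulli t ht
    rw [← e] at hb
    exact hb

end Scheme

/-! ### Stopping at a bounded total variance -/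

section Localization

variable {Ω 𝒳 : Type*} {mΩ : MeasurableSpace Ω} [MeasurableSpace 𝒳] {μ : Measure Ω}
  {X : ℕ → Ω → 𝒳} {Y ξ : ℕ → Ω → ℝ} {f : ℕ → Ω → 𝒳 → ℝ} {π : ℕ → Ω → 𝒳 → I} {n : ℕ}
  {P : Measure (𝒳 × ℝ)} {θ C : ℝ}

/-- The conditional second moment about `θ` of the increment with index `t`, as a
`[0, ∞]`-valued function that is measurable for the history. -/
noncomputable def condSecondMoment (P : Measure (𝒳 × ℝ)) (θ : ℝ) (f : ℕ → Ω → 𝒳 → ℝ)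
    (π : ℕ → Ω → 𝒳 → I) (t : ℕ) (ω : Ω) : ℝ≥0∞ :=
  ∫⁻ s, ENNReal.ofReal ((genericIncrement (f t ω) (π t ω) s - θ) ^ 2)
    ∂(P.prod (volume : Measure I))

/-- The normalization `1 / √n`, replaced by `0` from the first time on at which the accumulated
conditional second moment exceeds `C n`. The comparison includes the current term, which is known
from the past. -/
noncomputable def stoppedWeight (P : Measure (𝒳 × ℝ)) (θ C : ℝ) (n : ℕ) (f : ℕ → Ω → 𝒳 → ℝ)
    (π : ℕ → Ω → 𝒳 → I) (t : ℕ) (ω : Ω) : ℝ :=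
  if ∑ s ∈ Finset.range (t + 1), condSecondMoment P θ f π s ω ≤ ENNReal.ofReal (C * n)
    then (√(n : ℝ))⁻¹ else 0

/-- The conditional variance of the stopped and normalized increment. -/
noncomputable def stoppedVar (P : Measure (𝒳 × ℝ)) (θ C : ℝ) (n : ℕ) (f : ℕ → Ω → 𝒳 → ℝ)
    (π : ℕ → Ω → 𝒳 → I) (t : ℕ) (ω : Ω) : ℝ :=
  (ENNReal.ofReal (stoppedWeight P θ C n f π t ω ^ 2) * condSecondMoment P θ f π t ω).toReal

lemma ofReal_stoppedWeight_sq_le (P : Measure (𝒳 × ℝ)) (θ C : ℝ) (n : ℕ) (f : ℕ → Ω → 𝒳 → ℝ)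
    (π : ℕ → Ω → 𝒳 → I) (t : ℕ) (ω : Ω) :
    ENNReal.ofReal (stoppedWeight P θ C n f π t ω ^ 2) ≤ (n : ℝ≥0∞)⁻¹ := by
  unfold stoppedWeight
  split_ifs
  · rcases Nat.eq_zero_or_pos n with rfl | hn
    · simp
    · have : (0 : ℝ) < n := by exact_mod_cast hn
      rw [inv_pow, Real.sq_sqrt this.le, ENNReal.ofReal_inv_of_pos this, ENNReal.ofReal_natCast]
  · simp

/-- The weighted conditional second moments sum to at most `C`: at the last time with a nonzero
weight the accumulated second moment is still at most `C n`. -/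
lemma sum_stoppedWeight_sq_mul_le (P : Measure (𝒳 × ℝ)) (θ C : ℝ) (n : ℕ)
    (f : ℕ → Ω → 𝒳 → ℝ) (π : ℕ → Ω → 𝒳 → I) (ω : Ω) (k : ℕ) :
    ∑ t ∈ Finset.range k, ENNReal.ofReal (stoppedWeight P θ C n f π t ω ^ 2) *
      condSecondMoment P θ f π t ω ≤ ENNReal.ofReal C := by
  induction k with
  | zero => simp
  | succ k ih =>
    by_cases hk : ∑ s ∈ Finset.range (k + 1), condSecondMoment P θ f π s ω ≤ ENNReal.ofReal (C * n)
    · rcases Nat.eq_zero_or_pos n with rfl | hn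
      · simp [stoppedWeight]
      calc _ ≤ ∑ t ∈ Finset.range (k + 1), (n : ℝ≥0∞)⁻¹ * condSecondMoment P θ f π t ω := by
            gcongr with t ht
            exact ofReal_stoppedWeight_sq_le P θ C n f π t ω
        _ ≤ (n : ℝ≥0∞)⁻¹ * ENNReal.ofReal (C * n) := by
            rw [← Finset.mul_sum]; gcongr
        _ = ENNReal.ofReal C := by
            rw [ENNReal.ofReal_mul' (Nat.cast_nonneg n), ENNReal.ofReal_natCast, mul_comm,
              mul_assoc, ENNReal.mul_inv_cancel (by exact_mod_cast hn.ne')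
              (ENNReal.natCast_ne_top n), mul_one]
    · rw [Finset.sum_range_succ]
      have : stoppedWeight P θ C n f π k ω = 0 := if_neg hk
      simpa [this] using ih

lemma stoppedWeight_sq_mul_le (P : Measure (𝒳 × ℝ)) (θ C : ℝ) (n : ℕ)
    (f : ℕ → Ω → 𝒳 → ℝ) (π : ℕ → Ω → 𝒳 → I) (t : ℕ) (ω : Ω) :
    ENNReal.ofReal (stoppedWeight P θ C n f π t ω ^ 2) * condSecondMoment P θ f π t ω
      ≤ ENNReal.ofReal C := by
  refine le_trans ?_ (sum_stoppedWeight_sq_mul_le P θ C n f π ω (t + 1))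
  exact Finset.single_le_sum (f := fun t => ENNReal.ofReal (stoppedWeight P θ C n f π t ω ^ 2) *
    condSecondMoment P θ f π t ω) (fun _ _ => zero_le) (Finset.self_mem_range_succ t)

lemma stoppedWeight_eq {ω : Ω} (h : ∑ s ∈ Finset.range n, condSecondMoment P θ f π s ω ≤
    ENNReal.ofReal (C * n)) {t : ℕ} (ht : t < n) :
    stoppedWeight P θ C n f π t ω = (√(n : ℝ))⁻¹ :=
  if_pos ((Finset.sum_le_sum_of_subset (Finset.range_mono ht)).trans h)

variable [IsProbabilityMeasure P]

lemma IsSequentialScheme.measurable_genericIncrement [IsProbabilityMeasure μ]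
    (h : IsSequentialScheme μ P n X Y ξ f π) {t : ℕ} (ht : t < n) :
    Measurable[(history X Y ξ t).prod inferInstance]
      fun a : Ω × ((𝒳 × ℝ) × I) => genericIncrement (f t a.1) (π t a.1) a.2 :=
  @HasCondLaw.measurable_fun _ _ _ _ (history X Y ξ t) _ _ _ _ _ _ (h.hasCondLaw ht)

lemma IsSequentialScheme.measurable_condSecondMoment [IsProbabilityMeasure μ]
    (h : IsSequentialScheme μ P n X Y ξ f π) {t : ℕ} (ht : t < n) :
    Measurable[history X Y ξ t] (condSecondMoment P θ f π t) :=
  @Measurable.lintegral_prod_right' _ _ (history X Y ξ t) _ _ _ _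
    (((h.measurable_genericIncrement ht).sub_const θ).pow_const 2).ennreal_ofReal

lemma IsSequentialScheme.measurable_stoppedWeight [IsProbabilityMeasure μ]
    (h : IsSequentialScheme μ P n X Y ξ f π) {t : ℕ} (ht : t < n) :
    Measurable[history X Y ξ t] (stoppedWeight P θ C n f π t) := by
  have hs : Measurable[history X Y ξ t] fun ω =>
      ∑ s ∈ Finset.range (t + 1), condSecondMoment P θ f π s ω :=
    Finset.measurable_sum _ fun s hs => by
      have hst : s ≤ t := Nat.lt_succ_iff.1 (Finset.mem_range.1 hs)
      exact (h.measurable_condSecondMoment (hst.trans_lt ht)).mono (history_mono hst) le_rfl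
  exact Measurable.ite (hs measurableSet_Iic) measurable_const measurable_const

lemma IsSequentialScheme.condSecondMoment_ae_eq (h : IsSequentialScheme μ P n X Y ξ f π)
    (hθ : θ = ∫ p, p.2 ∂P) {t : ℕ} (ht : t < n) :
    ∀ᵐ ω ∂μ, condSecondMoment P θ f π t ω = ENNReal.ofReal (V P (f t ω) (π t ω)) := by
  filter_upwards [h.pair t ht] with ω hω
  rw [condSecondMoment, hθ, hω.lintegral_sq_eq]

/-- The stopped and normalized increments are martingale differences. Stopping is needed because
the conditional variances of a scheme are finite but need not be integrable. -/
lemma IsSequentialScheme.isMartingaleDiff [IsProbabilityMeasure μ]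
    (h : IsSequentialScheme μ P n X Y ξ f π) (hθ : θ = ∫ p, p.2 ∂P) (hC : 0 ≤ C) :
    IsMartingaleDiff μ n (history X Y ξ)
      (fun t ω => stoppedWeight P θ C n f π t ω * (Δ X Y ξ f π t ω - θ))
      (stoppedVar P θ C n f π) C := by
  have key : ∀ t < n, _ := fun t ht =>
    (h.hasCondLaw ht).martingaleDiff (θ := θ) (by
      filter_upwards [h.pair t ht] with ω hω
      exact ⟨hω.finite_variance.integrable (by norm_num),
        hω.integral_genericIncrement.trans hθ.symm⟩)
      (h.measurable_stoppedWeight (θ := θ) (C := C) ht) (M := ENNReal.ofReal C)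
      ENNReal.ofReal_ne_top fun ω => stoppedWeight_sq_mul_le P θ C n f π t ω
  simp only [MeasurableSpace.comap_id, id_eq] at key
  refine ⟨history_mono, fun t ht => h.history_le ht, fun t ht => ?_, fun t ht => (key t ht).1,
    fun t ht => (key t ht).2.1, fun t ht => (key t ht).2.2, fun t ht => ?_,
    fun t ht ω => ENNReal.toReal_nonneg, fun ω => ?_⟩
  · exact ((h.measurable_stoppedWeight ht).mono (history_mono (Nat.le_succ t)) le_rfl).mul
      ((h.measurable_increment ht).sub_const θ)
  · exact (((h.measurable_stoppedWeight ht).pow_const 2).ennreal_ofReal.mul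
      (h.measurable_condSecondMoment ht)).ennreal_toReal
  · unfold stoppedVar
    rw [← ENNReal.toReal_sum fun t _ => ((stoppedWeight_sq_mul_le P θ C n f π t ω).trans_lt
      ENNReal.ofReal_lt_top).ne]
    exact ENNReal.toReal_le_of_le_ofReal hC (sum_stoppedWeight_sq_mul_le P θ C n f π ω n)

/-- Where the average conditional variance is close to its limit `s`, nothing has been stopped. -/
lemma IsSequentialScheme.stopped_sums_ae_eq
    (h : IsSequentialScheme μ P n X Y ξ f π) (hθ : θ = ∫ p, p.2 ∂P) (hn : 0 < n) (s : ℝ) :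
    ∀ᵐ ω ∂μ, dist ((n : ℝ)⁻¹ * ∑ t ∈ Finset.range n, V P (f t ω) (π t ω)) s < 1 →
      ∑ t ∈ Finset.range n, stoppedVar P θ (s + 1) n f π t ω
        = (n : ℝ)⁻¹ * ∑ t ∈ Finset.range n, V P (f t ω) (π t ω) ∧
      ∑ t ∈ Finset.range n, stoppedWeight P θ (s + 1) n f π t ω * (Δ X Y ξ f π t ω - θ)
        = √(n : ℝ) * (estimator n X Y ξ f π ω - θ) := by
  have hall : ∀ᵐ ω ∂μ, ∀ t < n,
      condSecondMoment P θ f π t ω = ENNReal.ofReal (V P (f t ω) (π t ω)) := by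
    rw [ae_all_iff]; intro t
    by_cases ht : t < n
    · filter_upwards [h.condSecondMoment_ae_eq hθ ht] with ω hω _ using hω
    · exact ae_of_all _ fun ω ht' => absurd ht' ht
  filter_upwards [hall] with ω hω hd
  have hn0 : (0 : ℝ) < n := by exact_mod_cast hn
  have hV0 : ∀ t, 0 ≤ V P (f t ω) (π t ω) := fun t => variance_nonneg _ _
  have hle : ∑ t ∈ Finset.range n, condSecondMoment P θ f π t ω ≤
      ENNReal.ofReal ((s + 1) * n) := by
    rw [Finset.sum_congr rfl fun t ht => hω t (Finset.mem_range.1 ht),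
      ← ENNReal.ofReal_sum_of_nonneg fun t _ => hV0 t]
    refine ENNReal.ofReal_le_ofReal ?_
    have := (abs_lt.1 (by simpa [Real.dist_eq] using hd)).2
    have h2 : (n : ℝ)⁻¹ * ∑ t ∈ Finset.range n, V P (f t ω) (π t ω) ≤ s + 1 := by linarith
    rwa [inv_mul_le_iff₀ hn0, mul_comm] at h2
  have hsq : √(n : ℝ) ≠ 0 := (Real.sqrt_pos.2 hn0).ne'
  constructor
  · rw [Finset.mul_sum]
    refine Finset.sum_congr rfl fun t ht => ?_
    have ht := Finset.mem_range.1 ht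
    rw [stoppedVar, stoppedWeight_eq hle ht, hω t ht, ENNReal.toReal_mul,
      ENNReal.toReal_ofReal (sq_nonneg _), ENNReal.toReal_ofReal (hV0 t), inv_pow,
      Real.sq_sqrt hn0.le]
  · rw [Finset.sum_congr rfl fun t ht => by rw [stoppedWeight_eq hle (Finset.mem_range.1 ht)],
      ← Finset.mul_sum, Finset.sum_sub_distrib, estimator]
    simp only [Finset.sum_const, Finset.card_range, nsmul_eq_mul]
    have : (√(n : ℝ))⁻¹ = √(n : ℝ) * (n : ℝ)⁻¹ := by
      rw [inv_eq_iff_eq_inv, mul_inv, inv_inv, eq_comm, inv_mul_eq_iff_eq_mul₀ hsq,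
        Real.mul_self_sqrt hn0.le]
    rw [this]
    field_simp

/-- The expected Lindeberg sum of the stopped increments is at most the expectation of a truncation
of the conditional Lindeberg sum. -/
lemma IsSequentialScheme.sum_integral_tailSq_le [IsProbabilityMeasure μ]
    (h : IsSequentialScheme μ P n X Y ξ f π) (hθ : θ = ∫ p, p.2 ∂P) (hC : 0 ≤ C) (ε : ℝ) :
    ∃ g : Ω → ℝ≥0∞, (∀ᵐ ω ∂μ, g ω ≤ ENNReal.ofReal C) ∧
      (∀ ω, g ω ≤ lindebergSum μ θ ε n X Y ξ f π ω) ∧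
      ∑ t ∈ Finset.range n, ∫ ω, tailSq ε
        (stoppedWeight P θ C n f π t ω * (Δ X Y ξ f π t ω - θ)) ∂μ ≤ (∫⁻ ω, g ω ∂μ).toReal := by
  have hmd := h.isMartingaleDiff hθ hC
  set tail : ℝ → ℝ≥0∞ := {x | ε * √(n : ℝ) < |x - θ|}.indicator
    fun x => ENNReal.ofReal ((x - θ) ^ 2) with htail
  have htm : Measurable tail := by
    have hs : MeasurableSet {x : ℝ | ε * √(n : ℝ) < |x - θ|} :=
      measurableSet_lt measurable_const (by fun_prop)
    exact Measurable.indicator (by fun_prop) hs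
  have htle : ∀ x, tail x ≤ ENNReal.ofReal ((x - θ) ^ 2) := fun x =>
    Set.indicator_le_self' (fun _ _ => zero_le) x
  set l : ℕ → Ω → ℝ≥0∞ := fun t => condLExp (history X Y ξ t) μ
    fun ω => tail (Δ X Y ξ f π t ω)
  have hlm : ∀ t, Measurable[history X Y ξ t] (l t) := fun t => measurable_condLExp _ _ _
  have hlint : ∀ t < n, ∀ᵐ ω ∂μ, l t ω = ∫⁻ s, tail (genericIncrement (f t ω) (π t ω) s)
      ∂(P.prod (volume : Measure I)) := fun t ht => by
    have := (h.hasCondLaw ht).condLExp_ae_eq (h := fun x => tail x.2)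
      (htm.comp (@measurable_snd Ω ℝ (history X Y ξ t) _))
    simp only [MeasurableSpace.comap_id, id_eq] at this
    exact this
  set w := stoppedWeight P θ C n f π with hw
  have hgC : ∀ᵐ ω ∂μ, ∑ t ∈ Finset.range n, ENNReal.ofReal (w t ω ^ 2) * l t ω ≤
      ENNReal.ofReal C := by
    have hall : ∀ᵐ ω ∂μ, ∀ t < n, l t ω ≤ condSecondMoment P θ f π t ω := by
      rw [ae_all_iff]; intro t
      by_cases ht : t < n
      · filter_upwards [hlint t ht] with ω hω _
        rw [hω]
        exact lintegral_mono fun s => htle _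
      · exact ae_of_all _ fun ω ht' => absurd ht' ht
    filter_upwards [hall] with ω hω
    refine le_trans (Finset.sum_le_sum fun t ht => ?_)
      (sum_stoppedWeight_sq_mul_le P θ C n f π ω n)
    exact mul_le_mul_right (hω t (Finset.mem_range.1 ht)) _
  refine ⟨fun ω => ∑ t ∈ Finset.range n, ENNReal.ofReal (w t ω ^ 2) * l t ω, hgC, fun ω => ?_, ?_⟩
  · rw [lindebergSum, Finset.mul_sum]
    refine Finset.sum_le_sum fun t ht => ?_
    exact mul_le_mul_left (ofReal_stoppedWeight_sq_le P θ C n f π t ω) _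
  · have hgm : ∀ t ∈ Finset.range n, Measurable fun ω => ENNReal.ofReal (w t ω ^ 2) * l t ω :=
      fun t ht => by
        have ht := Finset.mem_range.1 ht
        exact ((((h.measurable_stoppedWeight ht).pow_const 2).ennreal_ofReal).mul (hlm t)).mono
          (h.history_le ht.le) le_rfl
    have hpt : ∀ t ω, ENNReal.ofReal (tailSq ε (w t ω * (Δ X Y ξ f π t ω - θ))) ≤
        ENNReal.ofReal (w t ω ^ 2) * tail (Δ X Y ξ f π t ω) := fun t ω => by
      have hwc : w t ω = 0 ∨ w t ω = (√(n : ℝ))⁻¹ := by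
        simp only [hw, stoppedWeight]
        split_ifs <;> simp
      rcases eq_or_ne (w t ω) 0 with h0 | h0
      · simp [tailSq, h0]
      have hwn := hwc.resolve_left h0
      have hsq : 0 < √(n : ℝ) :=
        (Real.sqrt_nonneg _).lt_of_ne fun h1 => h0 (by rw [hwn, ← h1]; simp)
      unfold tailSq
      split_ifs with hε
      · have hmem : Δ X Y ξ f π t ω ∈ {x | ε * √(n : ℝ) < |x - θ|} := by
          rw [abs_mul, hwn, abs_of_pos (inv_pos.2 hsq), inv_mul_eq_div, lt_div_iff₀ hsq] at hε
          exact hε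
        rw [htail, Set.indicator_of_mem hmem, mul_pow, ENNReal.ofReal_mul (sq_nonneg _)]
      · simp
    have hstep : ∀ t < n, ∫⁻ ω, ENNReal.ofReal (tailSq ε (w t ω * (Δ X Y ξ f π t ω - θ))) ∂μ ≤
        ∫⁻ ω, ENNReal.ofReal (w t ω ^ 2) * l t ω ∂μ := fun t ht => by
      refine (lintegral_mono (hpt t)).trans (le_of_eq ?_)
      have hwm := ((h.measurable_stoppedWeight (θ := θ) (C := C) ht).pow_const 2).ennreal_ofReal
      have := (h.hasCondLaw ht).lintegral_eq
        (h := fun x => ENNReal.ofReal (w t x.1 ^ 2) * tail x.2)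
        ((hwm.comp (@measurable_fst Ω ℝ (history X Y ξ t) _)).mul
          (htm.comp (@measurable_snd Ω ℝ (history X Y ξ t) _)))
      simp only [id_eq] at this
      rw [this]
      refine lintegral_congr_ae ?_
      filter_upwards [hlint t ht] with ω hω
      rw [hω]
      exact lintegral_const_mul' _ _ ENNReal.ofReal_ne_top
    have hlt : ∫⁻ ω, ∑ t ∈ Finset.range n, ENNReal.ofReal (w t ω ^ 2) * l t ω ∂μ < ∞ := by
      refine lt_of_le_of_lt (lintegral_mono_ae hgC) ?_
      simp
    rw [lintegral_finsetSum _ hgm] at hlt ⊢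
    have hle := Finset.sum_le_sum fun t ht => hstep t (Finset.mem_range.1 ht)
    refine le_trans (le_of_eq ?_) (ENNReal.toReal_mono hlt.ne hle)
    rw [ENNReal.toReal_sum fun t ht => ((hle.trans_lt hlt).trans_le' (Finset.single_le_sum
      (f := fun t => ∫⁻ ω, ENNReal.ofReal (tailSq ε (w t ω * (Δ X Y ξ f π t ω - θ))) ∂μ)
      (fun _ _ => zero_le) ht)).ne]
    refine Finset.sum_congr rfl fun t ht => ?_
    exact integral_eq_lintegral_of_nonneg_ae (ae_of_all _ fun ω => tailSq_nonneg _ _)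
      (integrable_tailSq (hmd.memLp t (Finset.mem_range.1 ht)) ε).aestronglyMeasurable

end Localization

/-! ### Limit theorem and confidence interval -/

section Limit

variable {Ω 𝒳 : Type*} [MeasurableSpace Ω] [MeasurableSpace 𝒳] {μ : Measure Ω}
  {P : Measure (𝒳 × ℝ)}

lemma IsSequentialScheme.measurable_estimator {n : ℕ} {X : ℕ → Ω → 𝒳} {Y ξ : ℕ → Ω → ℝ}
    {f : ℕ → Ω → 𝒳 → ℝ} {π : ℕ → Ω → 𝒳 → I} (h : IsSequentialScheme μ P n X Y ξ f π) :
    Measurable (estimator n X Y ξ f π) :=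
  (Finset.measurable_sum _ fun t ht => by
    have ht := Finset.mem_range.1 ht
    exact (h.measurable_increment ht).mono (h.history_le ht) le_rfl).const_mul _

/-- The normalized estimation error agrees with the stopped martingale sum outside an event of
vanishing probability, and the latter satisfies the martingale central limit theorem. -/
lemma tendstoInDistribution_estimator [IsProbabilityMeasure μ] [IsProbabilityMeasure P]
    {X : ℕ → ℕ → Ω → 𝒳} {Y ξ : ℕ → ℕ → Ω → ℝ}
    {f : ℕ → ℕ → Ω → 𝒳 → ℝ} {π : ℕ → ℕ → Ω → 𝒳 → I}
    (hscheme : ∀ n, IsSequentialScheme μ P n (X n) (Y n) (ξ n) (f n) (π n))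
    {θ : ℝ} (hθ : θ = ∫ p, p.2 ∂P) {s : ℝ} (hs : 0 ≤ s)
    (hvar : TendstoInMeasure μ
      (fun (n : ℕ) ω => (n : ℝ)⁻¹ * ∑ t ∈ Finset.range n, V P (f n t ω) (π n t ω))
      atTop (fun _ => s))
    (hlindeberg : ∀ ε : ℝ, 0 < ε → ∀ δ : ℝ, 0 < δ → Tendsto
      (fun n => μ {ω | ENNReal.ofReal δ ≤
        lindebergSum μ θ ε n (X n) (Y n) (ξ n) (f n) (π n) ω}) atTop (𝓝 0)) :
    TendstoInDistribution
      (fun (n : ℕ) ω => √(n : ℝ) * (estimator n (X n) (Y n) (ξ n) (f n) (π n) ω - θ))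
      atTop id (fun _ => μ) (gaussianReal 0 s.toNNReal) := by
  have hC : 0 ≤ s + 1 := by linarith
  have hvar' := tendstoInMeasure_iff_dist.1 hvar
  -- the average variance is within `min δ 1` of its limit with probability tending to one
  have hbad : ∀ δ : ℝ, 0 < δ → Tendsto (fun n : ℕ => μ {ω | min δ 1 ≤ dist ((n : ℝ)⁻¹ *
      ∑ t ∈ Finset.range n, V P (f n t ω) (π n t ω)) s}) atTop (𝓝 0) :=
    fun δ hδ => hvar' _ (lt_min hδ one_pos)
  have hclt := tendstoInDistribution_sum_of_isMartingaleDiff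
    (fun n => (hscheme n).isMartingaleDiff hθ hC) hs ?_ ?_
  · refine tendstoInDistribution_of_tendstoInMeasure_sub _ _ hclt ?_ fun n =>
      (((hscheme n).measurable_estimator.sub_const θ).const_mul _).aemeasurable
    refine tendstoInMeasure_iff_dist.2 fun δ hδ => ?_
    refine tendsto_of_tendsto_of_tendsto_of_le_of_le' tendsto_const_nhds (hbad δ hδ)
      (Eventually.of_forall fun _ => zero_le) ?_
    filter_upwards [eventually_gt_atTop 0] with n hn
    refine measure_mono_ae ?_
    filter_upwards [(hscheme n).stopped_sums_ae_eq hθ hn s] with ω hω hmem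
    by_contra hcon
    have h1 := (hω ((not_le.1 hcon).trans_le (min_le_right _ _))).2
    have hmem' : δ ≤ dist (√(n : ℝ) * (estimator n (X n) (Y n) (ξ n) (f n) (π n) ω - θ) -
      ∑ t ∈ Finset.range n, stoppedWeight P θ (s + 1) n (f n) (π n) t ω *
        (Δ (X n) (Y n) (ξ n) (f n) (π n) t ω - θ)) 0 := hmem
    rw [h1, sub_self, dist_self] at hmem'
    linarith
  · refine tendstoInMeasure_iff_dist.2 fun δ hδ => ?_
    refine tendsto_of_tendsto_of_tendsto_of_le_of_le' tendsto_const_nhds (hbad δ hδ)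
      (Eventually.of_forall fun _ => zero_le) ?_
    filter_upwards [eventually_gt_atTop 0] with n hn
    refine measure_mono_ae ?_
    filter_upwards [(hscheme n).stopped_sums_ae_eq hθ hn s] with ω hω hmem
    by_contra hcon
    have hlt := not_le.1 hcon
    have h1 := (hω (hlt.trans_le (min_le_right _ _))).1
    have hmem' : δ ≤ dist (∑ t ∈ Finset.range n,
      stoppedVar P θ (s + 1) n (f n) (π n) t ω) s := hmem
    rw [h1] at hmem'
    exact absurd hmem' (not_le.2 (hlt.trans_le (min_le_left _ _)))
  · intro ε hε
    choose g hgC hgL hg using fun n => (hscheme n).sum_integral_tailSq_le hθ hC ε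
    have h0 := tendsto_lintegral_zero_of_le_const (μ := μ) (g := g) ENNReal.ofReal_ne_top
      (Eventually.of_forall hgC) fun δ hδ =>
        tendsto_of_tendsto_of_tendsto_of_le_of_le tendsto_const_nhds (hlindeberg ε hε δ hδ)
          (fun _ => zero_le) fun n => measure_mono fun ω hω => le_trans hω (hgL n ω)
    have h1 := (ENNReal.tendsto_toReal ENNReal.zero_ne_top).comp h0
    exact tendsto_of_tendsto_of_tendsto_of_le_of_le tendsto_const_nhds h1
      (fun n => Finset.sum_nonneg fun t _ => integral_nonneg fun ω => tailSq_nonneg _ _) hg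

end Limit

section Quantile

lemma continuous_cdf (ν : Measure ℝ) [IsProbabilityMeasure ν] [NullSingletonClass ν] :
    Continuous (cdf ν) := by
  rw [continuous_iff_continuousAt]
  intro x
  rw [(monotone_cdf ν).continuousAt_iff_leftLim_eq_rightLim, StieltjesFunction.rightLim_eq]
  have h := (cdf ν).measure_singleton x
  rw [measure_cdf, measure_singleton] at h
  exact le_antisymm ((monotone_cdf ν).leftLim_le le_rfl)
    (sub_nonpos.1 (ENNReal.ofReal_eq_zero.1 h.symm))

lemma cdf_stdNormalQuantile {q : ℝ} (h0 : 0 < q) (h1 : q < 1) :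
    cdf (gaussianReal 0 1) (stdNormalQuantile q) = q := by
  have : NullSingletonClass (gaussianReal 0 1) := nullSingletonClass_gaussianReal one_ne_zero
  have hc := continuous_cdf (gaussianReal 0 1)
  obtain ⟨a, ha⟩ := ((tendsto_cdf_atBot (gaussianReal 0 1)).eventually_lt_const h0).exists
  obtain ⟨b, hb⟩ := ((tendsto_cdf_atTop (gaussianReal 0 1)).eventually_const_lt h1).exists
  have hbdd : BddBelow {x : ℝ | q ≤ cdf (gaussianReal 0 1) x} := ⟨a, fun x hx => by
    by_contra hlt
    exact absurd (hx.trans (monotone_cdf _ (not_le.1 hlt).le)) (not_le.2 ha)⟩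
  have hmem : stdNormalQuantile q ∈ {x : ℝ | q ≤ cdf (gaussianReal 0 1) x} :=
    (isClosed_le continuous_const hc).csInf_mem ⟨b, hb.le⟩ hbdd
  obtain ⟨x, hx⟩ := mem_range_of_exists_le_of_exists_ge hc ⟨a, ha.le⟩ ⟨b, hb.le⟩
  exact le_antisymm ((monotone_cdf _ (csInf_le hbdd hx.ge)).trans hx.le) hmem

/-- By the symmetry of the normal law, `[-z, z]` has mass `1 - α` for `z` the quantile of
`1 - α / 2`. -/
lemma gaussianReal_Icc_quantile {α : ℝ} (h0 : 0 < α) (h1 : α < 1) :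
    (gaussianReal 0 1).real
      (Set.Icc (-stdNormalQuantile (1 - α / 2)) (stdNormalQuantile (1 - α / 2))) = 1 - α := by
  have : NullSingletonClass (gaussianReal 0 1) := nullSingletonClass_gaussianReal one_ne_zero
  set z := stdNormalQuantile (1 - α / 2)
  have hΦ : cdf (gaussianReal 0 1) z = 1 - α / 2 :=
    cdf_stdNormalQuantile (by linarith) (by linarith)
  have hneg : (gaussianReal 0 1).real (Set.Iio (-z)) = α / 2 := by
    have e : (gaussianReal 0 1).map (fun x => -x) = gaussianReal 0 1 := by
      rw [gaussianReal_map_neg, neg_zero]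
    have e2 : (gaussianReal 0 1).real (Set.Iio (-z)) = (gaussianReal 0 1).real (Set.Iic z)ᶜ := by
      conv_lhs => rw [← e]
      rw [map_measureReal_apply measurable_neg measurableSet_Iio]
      congr 1
      ext x; simp
    rw [e2, measureReal_compl measurableSet_Iic, ← cdf_eq_real, hΦ]
    simp
  have hle : -z ≤ z := by
    by_contra hlt
    have := measureReal_mono (μ := gaussianReal 0 1) (Set.Iic_subset_Iio.2 (not_le.1 hlt))
    rw [hneg, ← cdf_eq_real, hΦ] at this
    linarith
  have hsub : Set.Iio (-z) ⊆ Set.Iic z := fun x hx => (le_of_lt hx).trans hle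
  rw [← Set.Iic_sdiff_Iio, measureReal_sdiff hsub measurableSet_Iio, hneg, ← cdf_eq_real, hΦ]
  ring

end Quantile

section Interval

variable {Ω : Type*} [MeasurableSpace Ω] {μ : Measure Ω} [IsProbabilityMeasure μ]

/-- Studentization: if `T n` is asymptotically `N(0, s)` and `v n` is consistent for `s > 0`,
then `|T n| ≤ z √(v n)` has asymptotic probability `1 - α`. -/
lemma tendsto_measureReal_abs_le {T v : ℕ → Ω → ℝ} {s : ℝ} (hs : 0 < s)
    (hT : TendstoInDistribution T atTop id (fun _ => μ) (gaussianReal 0 s.toNNReal))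
    (hv : TendstoInMeasure μ v atTop fun _ => s) (hvm : ∀ n, AEMeasurable (v n) μ)
    {α : ℝ} (h0 : 0 < α) (h1 : α < 1) :
    Tendsto (fun n => μ.real {ω | |T n ω| ≤ stdNormalQuantile (1 - α / 2) * √(v n ω)})
      atTop (𝓝 (1 - α)) := by
  have hz := gaussianReal_Icc_quantile h0 h1
  set z := stdNormalQuantile (1 - α / 2)
  have hss : 0 < √s := Real.sqrt_pos.2 hs
  have : NullSingletonClass (gaussianReal 0 s.toNNReal) :=
    nullSingletonClass_gaussianReal (by simpa using hs)
  have hg : Continuous fun x : ℝ × ℝ => |x.1| - z * √x.2 := by fun_prop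
  have hd := hT.continuous_comp_prodMk_of_tendstoInMeasure_const hg hv hvm
  have hfr : ((gaussianReal 0 s.toNNReal).map fun x => |id x| - z * √s) (frontier (Set.Iic 0))
      = 0 := by
    rw [frontier_Iic, Measure.map_apply (by fun_prop) (measurableSet_singleton 0)]
    refine measure_mono_null (t := {z * √s, -(z * √s)}) (fun x hx => ?_)
      (Set.Finite.measure_zero (by simp) _)
    have : |x| = z * √s := sub_eq_zero.1 hx
    exact eq_or_eq_neg_of_abs_eq this
  have hlim := ProbabilityMeasure.tendsto_measure_of_null_frontier_of_tendsto' hd.tendsto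
    (E := Set.Iic 0) hfr
  have hval : (gaussianReal 0 s.toNNReal).map (fun x => |id x| - z * √s) (Set.Iic 0)
      = ENNReal.ofReal (1 - α) := by
    have hgs : (gaussianReal 0 1).map (√s * ·) = gaussianReal 0 s.toNNReal := by
      rw [gaussianReal_map_const_mul, mul_zero, mul_one]
      congr 1
      ext
      simp [hs.le, Real.sq_sqrt hs.le]
    rw [← hz, ofReal_measureReal, Measure.map_apply (by fun_prop) measurableSet_Iic, ← hgs,
      Measure.map_apply (by fun_prop) (measurableSet_Iic.preimage (by fun_prop))]
    congr 1
    ext x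
    simp only [Set.mem_preimage, Set.mem_Iic, id_eq, Set.mem_Icc, sub_nonpos, abs_mul,
      abs_of_pos hss, mul_comm z, mul_le_mul_iff_right₀ hss, abs_le]
  have hlim' : Tendsto (fun n => (μ.map fun ω => |T n ω| - z * √(v n ω)) (Set.Iic 0)) atTop
      (𝓝 (ENNReal.ofReal (1 - α))) := by
    rw [← hval]; exact hlim
  have hfin := (ENNReal.tendsto_toReal ENNReal.ofReal_ne_top).comp hlim'
  rw [ENNReal.toReal_ofReal (by linarith)] at hfin
  refine hfin.congr fun n => ?_
  have hm : AEMeasurable (fun ω => |T n ω| - z * √(v n ω)) μ := hd.forall_aemeasurable n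
  rw [Function.comp_apply, Measure.map_apply_of_aemeasurable hm measurableSet_Iic]
  simp only [measureReal_def, Set.preimage, Set.mem_Iic, sub_nonpos]

end Interval

end ActiveInference

/-- For every sample size `n`, the arrays `X n`, `Y n`, `ξ n`, `f n`, `π n` describe an experiment
with `n` points (models and rules may depend on `n`, for instance through the labelling budget;
a single infinite sequence is the case of arrays that are constant in `n`). -/
theorem proposition2 {Ω 𝒳 : Type*} [MeasurableSpace Ω] [MeasurableSpace 𝒳]
    (μ : Measure Ω) [IsProbabilityMeasure μ]
    (P : Measure (𝒳 × ℝ)) [IsProbabilityMeasure P]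
    (X : ℕ → ℕ → Ω → 𝒳) (Y ξ : ℕ → ℕ → Ω → ℝ)
    (f : ℕ → ℕ → Ω → 𝒳 → ℝ) (π : ℕ → ℕ → Ω → 𝒳 → I)
    (hscheme : ∀ n, ActiveInference.IsSequentialScheme μ P n (X n) (Y n) (ξ n) (f n) (π n))
    (θ : ℝ) (hθ : θ = ∫ p, p.2 ∂P)
    (fstar : 𝒳 → ℝ) (πstar : 𝒳 → I) (hstar : ActiveInference.IsModelRulePair P fstar πstar)
    (hvar : TendstoInMeasure μ
      (fun (n : ℕ) ω => (n : ℝ)⁻¹ *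
        ∑ t ∈ Finset.range n, ActiveInference.V P (f n t ω) (π n t ω))
      atTop (fun _ => ActiveInference.V P fstar πstar))
    (hlindeberg : ∀ ε : ℝ, 0 < ε → ∀ δ : ℝ, 0 < δ → Tendsto
      (fun n => μ {ω | ENNReal.ofReal δ ≤
        ActiveInference.lindebergSum μ θ ε n (X n) (Y n) (ξ n) (f n) (π n) ω})
      atTop (𝓝 0)) :
    TendstoInDistribution
      (fun (n : ℕ) ω =>
        √(n : ℝ) * (ActiveInference.estimator n (X n) (Y n) (ξ n) (f n) (π n) ω - θ))
      atTop id (fun _ => μ) (gaussianReal 0 (ActiveInference.V P fstar πstar).toNNReal) ∧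
    (0 < ActiveInference.V P fstar πstar →
      ∀ σsqhat : ℕ → Ω → ℝ, (∀ n, AEMeasurable (σsqhat n) μ) →
      TendstoInMeasure μ σsqhat atTop (fun _ => ActiveInference.V P fstar πstar) →
      ∀ α : ℝ, 0 < α → α < 1 →
      Tendsto
        (fun n : ℕ => μ.real {ω | θ ∈ Set.Icc
          (ActiveInference.estimator n (X n) (Y n) (ξ n) (f n) (π n) ω
            - ActiveInference.stdNormalQuantile (1 - α / 2) * (√(σsqhat n ω) / √(n : ℝ)))
          (ActiveInference.estimator n (X n) (Y n) (ξ n) (f n) (π n) ω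
            + ActiveInference.stdNormalQuantile (1 - α / 2) * (√(σsqhat n ω) / √(n : ℝ)))})
        atTop (𝓝 (1 - α))) := by
  have hs : 0 ≤ ActiveInference.V P fstar πstar := variance_nonneg _ _
  have hclt := ActiveInference.tendstoInDistribution_estimator hscheme hθ hs hvar hlindeberg
  refine ⟨hclt, fun hpos σsqhat hσm hσ α h0 h1 => ?_⟩
  refine (ActiveInference.tendsto_measureReal_abs_le hpos hclt hσ hσm h0 h1).congr' ?_
  filter_upwards [eventually_gt_atTop 0] with n hn
  have hsq : 0 < √(n : ℝ) := Real.sqrt_pos.2 (by exact_mod_cast hn)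
  congr 1
  ext ω
  rw [Set.mem_ofPred_eq, Set.mem_ofPred_eq, Set.mem_Icc, abs_mul, abs_of_pos hsq, ← mul_div_assoc,
    mul_comm, ← le_div_iff₀ hsq, abs_le]
  constructor <;> rintro ⟨ha, hb⟩ <;> constructor <;> linarith
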